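/- Let $n,N\in\mathbb N$ and let the components of $x\in\mathbb R^n$ be partitioned into subvectors $x_i\in\mathbb R^{n_i}$, $i=1,\dots,N$. Let $f(x)=\sum_{i=1}^N f_i(x_i)$, where each $f_i:\mathbb R^{n_i}\to(-\infty,+\infty]$ is proper, lower semicontinuous and bounded below, and $f$ is continuous on $\mathrm{dom}(f)$; let $h:\mathbb R^n\to(-\infty,+\infty]$ be proper and lower semicontinuous; let $g:\mathbb R^n\to[0,\infty)$ be convex with $\Omega:=\{x: g(x)\ne 0\}\neq\emptyset$; suppose that $h$ is finite and differentiable on $\Omega$, that each $x\in\Omega$ has a neighbourhood $B$ such that $\nabla h$ is Lipschitz on $B\cap\Omega$, and that $f+h\ge 0$ on $\mathrm{dom}(f)$. Put $\zeta=f+h$, $\eta(x,y)=\langle x,y\rangle-g^*(y)$ with the Fenchel conjugate $g^*$, and $F(x)=\zeta(x)/g(x)$ if $x\in\Omega\cap\mathrm{dom}(f)$, $F(x)=+\infty$ otherwise; $Q(x,y)=\zeta(x)/\eta(x,y)$ if $x\in\mathrm{dom}(f)$, $y\in\mathrm{dom}(g^*)$ and $\eta(x,y)>0$, $Q(x,y)=+\infty$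 otherwise. For a function $\varphi$ and a point $u$ let $\mathrm{prox}_\varphi(u)=\arg\min_z\{\varphi(z)+\frac12\|z-u\|_2^2\}$ (a set). A point $x^\star\in\mathrm{dom}(F)$ is a critical point of $F$ if $0\in\widehat\partial f(x^\star)+\nabla h(x^\star)-F(x^\star)\,\partial g(x^\star)$, where $\widehat\partial$ is the Fréchet subdifferential and $\partial g$ the convex subdifferential. Fix $x^{(0)}\in\mathrm{dom}(F)$, $y^{(0)}\in\partial g(x^{(0)})$, $0<\underline\alpha\le\overline\alpha$, $\sigma>0$, $0<\gamma<1$, an integer $M\ge 0$ and $p_{\min}>0$. The randomized multi-proximity gradient algorithm (RMPGA) generates random points $(x^{(t)},y^{(t)})$, $t\in\mathbb N$, as follows. At iteration $t$, given the past, it picks an index $i\in\{0,1,\dots,N\}$ with probability $p^{(t)}_i\ge p_{\min}$, where $\sum_{i=0}^N p_i^{(t)}=1$. * If $i=0$: $x^{(t+1)}=x^{(t)}$ and $y^{(t+1)}=\mathrm{prox}_{\alpha g^*}(y^{(t)}+\alpha x^{(t)})$ for some $\alpha\in[\underline\alpha,\overline\alpha]$. * If $i\ge1$: $y^{(t+1)}=y^{(t)}$.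 For some $\widetilde\alpha\in[\underline\alpha,\overline\alpha]$ the step sizes $\alpha=\widetilde\alpha,\widetilde\alpha\gamma,\widetilde\alpha\gamma^2,\dots$ are tried in turn; for each, some $z\in\mathrm{prox}_{\alpha f_i}\big(x_i^{(t)}-\alpha\nabla_i h(x^{(t)})+\alpha Q(x^{(t)},y^{(t)})y_i^{(t)}\big)$ is computed and $x^{+}$ denotes $x^{(t)}$ with its $i$-th subvector replaced by $z$; $x^{(t+1)}$ is the first $x^+$ that satisfies $$\zeta(x^+)+\tfrac{\sigma}{2}\|x^+-x^{(t)}\|_2^2\le \Big(\max_{\max\{t-M,0\}\le s\le t}Q(x^{(s)},y^{(s)})\Big)\,\eta(x^+,y^{(t)}).$$ Suppose that the level set $\{x\in\mathbb R^n:F(x)\le F(x^{(0)})\}$ is compact. Then almost surely every accumulation point $(x^\star,y^\star)$ of the sequence $\{(x^{(t)},y^{(t)})\}_{t\in\mathbb N}$ generated by RMPGA is such that $x^\star\in\mathrm{dom}(F)$ is a critical point of $F$ and $F(x^\star)y^\star\in F(x^\star)\,\partial g(x^\star)$. -/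

import Mathlib

open MeasureTheory ProbabilityTheory Filter Topology
open scoped Pointwise InnerProductSpace

noncomputable section

/-- `ℝⁿ` with the Euclidean norm and inner product. -/
abbrev Rn (n : ℕ) : Type := EuclideanSpace ℝ (Fin n)

/-- The space `ℝ^{n_i}` of the `i`-th subvectors, for the partition of the `n` components into `N`
blocks that assigns component `j` to block `blk j`. -/
abbrev BlockSpace {n N : ℕ} (blk : Fin n → Fin N) (i : Fin N) : Type :=
  EuclideanSpace ℝ {j : Fin n // blk j = i}

/-- The subvector `x_i` of `x`. -/
def subvec {n N : ℕ} (blk : Fin n → Fin N) (i : Fin N) (x : Rn n) : BlockSpace blk i :=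
  WithLp.toLp 2 (fun j => x j.1)

/-- The vector `[x₁; …; x_{i-1}; z; x_{i+1}; …; x_N]`. -/
def replaceBlock {n N : ℕ} (blk : Fin n → Fin N) (i : Fin N) (x : Rn n) (z : BlockSpace blk i) :
    Rn n :=
  WithLp.toLp 2 (fun j => if hj : blk j = i then z ⟨j, hj⟩ else x j)

section ConvexAnalysis

variable {V : Type*} [NormedAddCommGroup V] [InnerProductSpace ℝ V]

/-- The effective domain of an extended-real-valued function. -/
def effDom (φ : V → EReal) : Set V := {x | φ x < ⊤}

/-- `prox_φ(x) = argmin { φ(z) + ½‖z - x‖² }`, as a set. -/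
def prox (φ : V → EReal) (x : V) : Set V :=
  {z | ∀ w, φ z + ((1 / 2 * ‖z - x‖ ^ 2 : ℝ) : EReal) ≤ φ w + ((1 / 2 * ‖w - x‖ ^ 2 : ℝ) : EReal)}

/-- The Fréchet subdifferential of `φ` at a point `x` of its domain (empty off the domain). -/
def frechetSubdiff (φ : V → EReal) (x : V) : Set V :=
  {v | x ∈ effDom φ ∧
    0 ≤ liminf (fun z => (φ z - φ x - ((⟪v, z - x⟫_ℝ : ℝ) : EReal)) / ((‖z - x‖ : ℝ) : EReal))
      (𝓝[≠] x)}

/-- The subdifferential of a real-valued convex function. -/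
def convexSubdiff (g : V → ℝ) (x : V) : Set V :=
  {v | ∀ z, g x + ⟪v, z - x⟫_ℝ ≤ g z}

/-- The Fenchel conjugate `g^*(y) = sup_x (⟨x, y⟩ - g(x))`. -/
def conjugate (g : V → ℝ) (y : V) : EReal :=
  ⨆ x : V, ((⟪x, y⟫_ℝ - g x : ℝ) : EReal)

end ConvexAnalysis

/-- The data of the problem `min { (f(x) + h(x)) / g(x) : g(x) ≠ 0 }` with
`f(x) = ∑ᵢ fᵢ(xᵢ)`. -/
structure FracProblem (n N : ℕ) where
  /-- the block to which a component belongs -/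
  blk : Fin n → Fin N
  /-- the block functions `fᵢ` -/
  fi : (i : Fin N) → BlockSpace blk i → EReal
  h : Rn n → EReal
  g : Rn n → ℝ

namespace FracProblem

variable {n N : ℕ} (P : FracProblem n N)

/-- `f(x) = ∑ᵢ fᵢ(xᵢ)`. -/
def f (x : Rn n) : EReal := ∑ i, P.fi i (subvec P.blk i x)

/-- `Ω = {x : g(x) ≠ 0}`. -/
def Omega : Set (Rn n) := {x | P.g x ≠ 0}

/-- The gradient of `h`; it is used only at points of the open set `Ω`, on which `h` is finite. -/
def gradh (x : Rn n) : Rn n := gradient (fun z => (P.h z).toReal) x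

/-- `ζ = f + h`. -/
def zeta (x : Rn n) : EReal := P.f x + P.h x

/-- `η(x, y) = ⟨x, y⟩ - g^*(y)`. -/
def eta (x y : Rn n) : EReal := ((⟪x, y⟫_ℝ : ℝ) : EReal) - conjugate P.g y

open Classical in
/-- The extended objective of the fractional problem. -/
def F (x : Rn n) : EReal :=
  if x ∈ P.Omega ∩ effDom P.f then P.zeta x / ((P.g x : ℝ) : EReal) else ⊤

open Classical in
/-- The extended objective of the primal-dual reformulation. -/
def Q (x y : Rn n) : EReal :=
  if x ∈ effDom P.f ∧ y ∈ effDom (conjugate P.g) ∧ 0 < P.eta x y then P.zeta x / P.eta x y else ⊤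

/-- The standing assumptions on the problem. -/
structure Standing : Prop where
  fi_ne_bot : ∀ i z, P.fi i z ≠ ⊥
  fi_proper : ∀ i, (effDom (P.fi i)).Nonempty
  fi_lsc : ∀ i, LowerSemicontinuous (P.fi i)
  h_ne_bot : ∀ x, P.h x ≠ ⊥
  h_proper : (effDom P.h).Nonempty
  h_lsc : LowerSemicontinuous P.h
  Omega_nonempty : P.Omega.Nonempty
  f_continuousOn : ContinuousOn P.f (effDom P.f)
  fi_bddBelow : ∀ i, ∃ m : ℝ, ∀ z, (m : EReal) ≤ P.fi i z
  h_finite : ∀ x ∈ P.Omega, P.h x ≠ ⊤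
  h_differentiable : ∀ x ∈ P.Omega, DifferentiableAt ℝ (fun z => (P.h z).toReal) x
  gradh_locallyLipschitz : ∀ x ∈ P.Omega, ∃ U ∈ 𝓝 x, ∃ L : ℝ,
    ∀ u ∈ U ∩ P.Omega, ∀ v ∈ U ∩ P.Omega, ‖P.gradh u - P.gradh v‖ ≤ L * ‖u - v‖
  g_convex : ConvexOn ℝ Set.univ P.g
  g_nonneg : ∀ x, 0 ≤ P.g x
  zeta_nonneg : ∀ x ∈ effDom P.f, 0 ≤ P.zeta x

/-- `x ∈ dom(F)` is a critical point of `F` if `0 ∈ ∂̂f(x) + ∇h(x) - F(x) ∂g(x)`. -/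
def IsCritical (x : Rn n) : Prop :=
  x ∈ effDom P.F ∧
    (0 : Rn n) ∈ frechetSubdiff P.f x + {P.gradh x} - (P.F x).toReal • convexSubdiff P.g x

end FracProblem

/-- The parameters `0 < α̲ ≤ ᾱ`, `σ > 0`, `0 < γ < 1` and `M ≥ 0` of the algorithm. -/
structure MPGAParams where
  αlo : ℝ
  αhi : ℝ
  σ : ℝ
  γ : ℝ
  M : ℕ
  αlo_pos : 0 < αlo
  αlo_le_αhi : αlo ≤ αhi
  σ_pos : 0 < σ
  γ_pos : 0 < γ
  γ_lt_one : γ < 1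

namespace FracProblem

variable {n N : ℕ} (P : FracProblem n N)

/-- Step 2-Y from `(x, y)`, with some step size in `[α̲, ᾱ]`; `(x', y')` is the new iterate.
(The proximity operator of `g^*` is single-valued.) -/
def StepY (c : MPGAParams) (x y x' y' : Rn n) : Prop :=
  x' = x ∧ ∃ α ∈ Set.Icc c.αlo c.αhi, y' ∈ prox (fun v => (α : EReal) * conjugate P.g v) (y + α • x)

/-- The possible trial subvectors of Step 2-X at `(x, y)` for block `i` and step size `α`. -/
def trialSet (i : Fin N) (α : ℝ) (x y : Rn n) : Set (BlockSpace P.blk i) :=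
  prox (fun z => (α : EReal) * P.fi i z)
    (subvec P.blk i x - α • subvec P.blk i (P.gradh x)
      + (α * (P.Q x y).toReal) • subvec P.blk i y)

/-- The line-search test for the trial subvector `z`; `q` is the reference value `Q_{(l(t))}`. -/
def LineSearchTest (c : MPGAParams) (q : EReal) (i : Fin N) (x y : Rn n) (z : BlockSpace P.blk i) :
    Prop :=
  P.zeta (replaceBlock P.blk i x z)
      + ((c.σ / 2 * ‖replaceBlock P.blk i x z - x‖ ^ 2 : ℝ) : EReal)
    ≤ q * P.eta (replaceBlock P.blk i x z) y

/-- Step 2-X for block `i` from `(x, y)`: the trial step sizes are `α, αγ, αγ², …` for some initial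
`α ∈ [α̲, ᾱ]`, for each of them some trial subvector is computed, and the first one that passes the
test (here the `k`-th) is accepted. -/
def StepX (c : MPGAParams) (q : EReal) (i : Fin N) (x y x' y' : Rn n) : Prop :=
  y' = y ∧ ∃ α ∈ Set.Icc c.αlo c.αhi, ∃ (k : ℕ) (z : ℕ → BlockSpace P.blk i),
    (∀ j ≤ k, z j ∈ P.trialSet i (α * c.γ ^ j) x y) ∧
    (∀ j < k, ¬ P.LineSearchTest c q i x y (z j)) ∧
    P.LineSearchTest c q i x y (z k) ∧
    x' = replaceBlock P.blk i x (z k)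

/-- `Q_{(l(t))} = max { Q(x⁽ˢ⁾, y⁽ˢ⁾) : [t - M]₊ ≤ s ≤ t }` (the subtraction on `ℕ` truncates
at `0`). -/
def refValue (c : MPGAParams) (x y : ℕ → Rn n) (t : ℕ) : EReal :=
  (Finset.Icc (t - c.M) t).sup (fun s => P.Q (x s) (y s))

/-- The sequence `(x⁽ᵗ⁾, y⁽ᵗ⁾)` is generated by the multi-proximity gradient algorithm from
`(x₀, y₀)` with the picked indices `idx t ∈ {0, …, N}`: index `0` is the block `y`, and index
`i + 1` is the `i`-th block of `x` (blocks are numbered from zero). -/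
structure IsMPGARun (c : MPGAParams) (x₀ y₀ : Rn n) (idx : ℕ → Fin (N + 1)) (x y : ℕ → Rn n) :
    Prop where
  init_x : x 0 = x₀
  init_y : y 0 = y₀
  step_y : ∀ t, idx t = 0 → P.StepY c (x t) (y t) (x (t + 1)) (y (t + 1))
  step_x : ∀ t (i : Fin N), idx t = i.succ →
    P.StepX c (P.refValue c x y t) i (x t) (y t) (x (t + 1)) (y (t + 1))

/-- The random sequence `(x⁽ᵗ⁾, y⁽ᵗ⁾)` is generated by the randomized algorithm: almost every
path is generated by the algorithm, and, given the information `ℱ t` available before iteration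
`t`, the index picked at iteration `t` is `i` with probability `p t i ≥ pmin`. The probabilities
may (but need not) depend on the past. -/
structure IsRMPGA {S : Type*} {mS : MeasurableSpace S} (μ : Measure S) (ℱ : Filtration ℕ mS)
    (c : MPGAParams) (x₀ y₀ : Rn n) (pmin : ℝ) (p : ℕ → Fin (N + 1) → S → ℝ)
    (idx : ℕ → S → Fin (N + 1)) (x y : ℕ → S → Rn n) : Prop where
  x_adapted : ∀ t, Measurable[ℱ t] (x t)
  y_adapted : ∀ t, Measurable[ℱ t] (y t)
  idx_measurable : ∀ t, Measurable (idx t)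
  p_condProb : ∀ t i, p t i =ᵐ[μ] μ⟦idx t ⁻¹' {i} | ℱ t⟧
  p_ge : ∀ t i, ∀ᵐ ω ∂μ, pmin ≤ p t i ω
  p_sum : ∀ t, ∀ᵐ ω ∂μ, ∑ i, p t i ω = 1
  run : ∀ᵐ ω ∂μ, P.IsMPGARun c x₀ y₀ (fun t => idx t ω) (fun t => x t ω) (fun t => y t ω)

end FracProblem

end

/-!
Write `η_t = η(x_t, y_t)`, `ζ_t = ζ(x_t)` and let `R_t` be the reference value of the line search.

*Every run.* All iterates stay in the compact level set `{F ≤ F(x₀)} ⊆ Ω ∩ dom f`, with `η_t > 0`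
and `ζ_t / η_t ≤ R_t`. Both kinds of steps satisfy
`ζ_{t+1} + σ/2 ‖x_{t+1} - x_t‖² ≤ R_t η_{t+1}`: for the `x`-steps this is the line-search test, for
the `y`-steps it holds because a proximal step on `g^*` increases `η`
(`inner_sub_conjugate_add_le`). Hence `R_t` decreases to some `q ≥ 0`, and a nonmonotone descent
argument (`tendsto_zero_of_window_nonneg`) applied to `ζ_t - q η_t` shows that this quantity and the
increments of `x` tend to zero (`RealRun.exists_limit`). Two consequences concern the times at which
a given index is picked. At `y`-steps, the new `y` is a subgradient of `g` at a point near `x_t`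
(Moreau), so that `ζ_t (g(x_t) - η_t) → 0` (`RealRun.eventually_gap_le`). At updates of the block
`i` with `η_t` bounded away from zero, the line search accepts a step size bounded away from zero
(`Standing.exists_stepsize`, from the descent lemma for `h`), so the optimality of the proximal
point yields a quadratic minorization of `f_i` at `x_t`, up to a vanishing error
(`RealRun.exists_eventually_block_optimal`).

*Almost every run.* Both consequences are statements about the current state alone, which is known
before the index is drawn. As each index has conditional probability at least `pmin`, a state
condition that holds at all late times at which a given index is picked almost surely holds at all
late times (`ae_eventually_notMem_of_le_measure_inter`). The indices are not assumed to be adapted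
to the filtration, and this form of the Borel–Cantelli argument does not need it.

*Accumulation points.* If `ζ(x⋆) = 0`, then `x⋆` minimizes `ζ ≥ 0` and is critical for this reason.
Otherwise `η_t → g(x⋆)` along the subsequence, so `y⋆` is a subgradient of `g` at `x⋆` and the
quotients `ζ_t / η_t` tend to `F(x⋆)`; the sum over the blocks of the limiting quadratic
minorizations says that `F(x⋆) y⋆ - ∇h(x⋆)` is a Fréchet subgradient of `f` at `x⋆`.
-/

/-! ### Subgradients and the Fenchel conjugate -/

section ConvexTools

variable {V : Type*} [NormedAddCommGroup V] [InnerProductSpace ℝ V]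

/-- A continuous convex function has a subgradient everywhere: separate the point `(x, g x)` from
the open strict epigraph. -/
theorem convexSubdiff_nonempty [CompleteSpace V] {g : V → ℝ} (hg : ConvexOn ℝ Set.univ g)
    (hc : Continuous g) (x : V) : (convexSubdiff g x).Nonempty := by
  have hconv := hg.convex_strict_epigraph
  have hopen : IsOpen {p : V × ℝ | p.1 ∈ Set.univ ∧ g p.1 < p.2} := by
    simp only [Set.mem_univ, true_and]
    exact isOpen_lt (hc.comp continuous_fst) continuous_snd
  obtain ⟨φ, hφ⟩ := geometric_hahn_banach_open_point (x := (x, g x)) hconv hopen (by simp)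
  have hsplit : ∀ (z : V) (r : ℝ), φ (z, r) = φ (z, 0) + r * φ (0, 1) := by
    intro z r
    have h : ((z, r) : V × ℝ) = (z, 0) + r • ((0, 1) : V × ℝ) := by simp
    rw [h, map_add, map_smul, smul_eq_mul]
  set k := φ (0, 1) with hk
  have hlt : ∀ z r, g z < r → φ (z, 0) + r * k < φ (x, 0) + g x * k := by
    intro z r hr
    have h := hφ (z, r) ⟨Set.mem_univ _, hr⟩
    rwa [hsplit z r, hsplit x (g x)] at h
  have hk0 : k < 0 := by
    have h := hlt x (g x + 1) (by linarith)
    linarith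
  have hle : ∀ z, φ (z, 0) + g z * k ≤ φ (x, 0) + g x * k := by
    intro z
    refine le_of_forall_pos_le_add fun ε hε => ?_
    have h := hlt z (g z + ε / (-k)) (by have := div_pos hε (neg_pos.2 hk0); linarith)
    have h2 : ε / (-k) * k = -ε := by
      rw [div_neg, neg_mul, div_mul_cancel₀ _ hk0.ne]
    nlinarith
  let ψ : V →L[ℝ] ℝ := φ.comp (ContinuousLinearMap.inl ℝ V ℝ)
  refine ⟨(InnerProductSpace.toDual ℝ V).symm ((-k)⁻¹ • ψ), fun z => ?_⟩
  rw [InnerProductSpace.toDual_symm_apply]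
  have h := hle z
  have hψ : ((-k)⁻¹ • ψ) (z - x) = (-k)⁻¹ * (φ (z, 0) - φ (x, 0)) := by
    simp [ψ, ← map_sub]
  rw [hψ]
  have hk' : 0 < -k := neg_pos.2 hk0
  have : (-k)⁻¹ * (φ (z, 0) - φ (x, 0)) ≤ g z - g x := by
    rw [inv_mul_le_iff₀ hk']; linarith
  linarith

theorem coe_le_conjugate (g : V → ℝ) (x y : V) :
    ((⟪x, y⟫_ℝ - g x : ℝ) : EReal) ≤ conjugate g y :=
  le_iSup (fun x : V => ((⟪x, y⟫_ℝ - g x : ℝ) : EReal)) x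

theorem conjugate_ne_bot (g : V → ℝ) (y : V) : conjugate g y ≠ ⊥ := by
  intro h
  have := coe_le_conjugate g 0 y
  rw [h] at this
  exact (EReal.coe_ne_bot _) (le_bot_iff.1 this)

theorem coe_toReal_conjugate {g : V → ℝ} {y : V} (hy : y ∈ effDom (conjugate g)) :
    ((conjugate g y).toReal : EReal) = conjugate g y :=
  EReal.coe_toReal (ne_of_lt hy) (conjugate_ne_bot g y)

/-- The Fenchel–Young inequality. -/
theorem inner_sub_toReal_conjugate_le {g : V → ℝ} {y : V} (hy : y ∈ effDom (conjugate g)) (x : V) :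
    ⟪x, y⟫_ℝ - (conjugate g y).toReal ≤ g x := by
  have h := coe_le_conjugate g x y
  rw [← coe_toReal_conjugate hy, EReal.coe_le_coe_iff] at h
  linarith

/-- Equality holds in the Fenchel–Young inequality at subgradients. -/
theorem conjugate_eq_of_mem_convexSubdiff {g : V → ℝ} {x y : V} (h : y ∈ convexSubdiff g x) :
    conjugate g y = ((⟪x, y⟫_ℝ - g x : ℝ) : EReal) := by
  refine le_antisymm (iSup_le fun z => ?_) (coe_le_conjugate g x y)
  rw [EReal.coe_le_coe_iff]
  have hz := h z
  rw [inner_sub_right, real_inner_comm z y, real_inner_comm x y] at hz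
  linarith

theorem mem_effDom_conjugate_of_mem_convexSubdiff {g : V → ℝ} {x y : V}
    (h : y ∈ convexSubdiff g x) : y ∈ effDom (conjugate g) := by
  change conjugate g y < ⊤
  rw [conjugate_eq_of_mem_convexSubdiff h]
  exact EReal.coe_lt_top _

theorem toReal_conjugate_of_mem_convexSubdiff {g : V → ℝ} {x y : V} (h : y ∈ convexSubdiff g x) :
    (conjugate g y).toReal = ⟪x, y⟫_ℝ - g x := by
  rw [conjugate_eq_of_mem_convexSubdiff h, EReal.toReal_coe]

/-- Conversely, equality in the Fenchel–Young inequality holds only at subgradients. -/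
theorem mem_convexSubdiff_of_le {g : V → ℝ} {x y : V} (hy : y ∈ effDom (conjugate g))
    (h : g x ≤ ⟪x, y⟫_ℝ - (conjugate g y).toReal) : y ∈ convexSubdiff g x := by
  intro z
  have hz := inner_sub_toReal_conjugate_le hy z
  rw [inner_sub_right, real_inner_comm z y, real_inner_comm x y]
  linarith

/-- Real-valued form of membership in the proximity operator of `α φ`, relative to a point at which
`φ` is finite. -/
theorem mem_prox_mul_real {W : Type*} [NormedAddCommGroup W] {φ : W → EReal}
    (hbot : ∀ z, φ z ≠ ⊥) {α : ℝ} (hα : 0 < α) {u z w₀ : W}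
    (hw₀ : w₀ ∈ effDom φ) (hz : z ∈ prox (fun v => (α : EReal) * φ v) u) :
    z ∈ effDom φ ∧ ∀ w ∈ effDom φ,
      α * (φ z).toReal + 1 / 2 * ‖z - u‖ ^ 2 ≤ α * (φ w).toReal + 1 / 2 * ‖w - u‖ ^ 2 := by
  have hdom : z ∈ effDom φ := by
    by_contra hcon
    have htop : φ z = ⊤ := not_lt_top_iff.1 hcon
    have h := hz w₀
    simp only [htop, EReal.coe_mul_top_of_pos hα, EReal.top_add_coe, top_le_iff] at h
    rw [← EReal.coe_toReal (ne_of_lt hw₀) (hbot w₀), ← EReal.coe_mul, ← EReal.coe_add] at h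
    exact EReal.coe_ne_top _ h
  refine ⟨hdom, fun w hw => ?_⟩
  have h := hz w
  simp only at h
  rw [← EReal.coe_toReal (ne_of_lt hw) (hbot w), ← EReal.coe_toReal (ne_of_lt hdom) (hbot z)] at h
  exact_mod_cast h

theorem conjugate_combination_le {g : V → ℝ} {y s : V} (hy : y ∈ effDom (conjugate g))
    (hs : s ∈ effDom (conjugate g)) {θ : ℝ} (h0 : 0 ≤ θ) (h1 : θ ≤ 1) :
    conjugate g (y + θ • (s - y)) ≤
      (((1 - θ) * (conjugate g y).toReal + θ * (conjugate g s).toReal : ℝ) : EReal) := by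
  refine iSup_le fun z => ?_
  rw [EReal.coe_le_coe_iff]
  have h1' := inner_sub_toReal_conjugate_le hy z
  have h2' := inner_sub_toReal_conjugate_le hs z
  rw [inner_add_right, inner_smul_right, inner_sub_right]
  nlinarith [mul_le_mul_of_nonneg_left h1' (sub_nonneg.2 h1), mul_le_mul_of_nonneg_left h2' h0]

/-- A proximal step on `g^*` produces a subgradient of `g` (Moreau's identity). -/
theorem mem_convexSubdiff_of_mem_prox_conjugate [CompleteSpace V] {g : V → ℝ}
    (hg : ConvexOn ℝ Set.univ g) (hc : Continuous g) {α : ℝ} (hα : 0 < α) {x y y' : V}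
    (h : y' ∈ prox (fun v => (α : EReal) * conjugate g v) (y + α • x)) :
    y' ∈ convexSubdiff g (x + α⁻¹ • (y - y')) := by
  set x' := x + α⁻¹ • (y - y') with hx'
  obtain ⟨s, hs⟩ := convexSubdiff_nonempty hg hc x'
  have hsd := mem_effDom_conjugate_of_mem_convexSubdiff hs
  obtain ⟨hyd, hmin⟩ := mem_prox_mul_real (conjugate_ne_bot g) hα hsd h
  have hu : y' - (y + α • x) = -(α • x') := by
    rw [hx', smul_add, smul_smul, mul_inv_cancel₀ hα.ne', one_smul]; abel
  -- Compare `y'` with the points `y' + θ (s - y')`, divide by `θ` and let `θ → 0`.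
  have hθ : ∀ θ : ℝ, 0 < θ → θ ≤ 1 →
      0 ≤ α * ((conjugate g s).toReal - (conjugate g y').toReal - ⟪x', s - y'⟫_ℝ)
        + θ * (1 / 2 * ‖s - y'‖ ^ 2) := by
    intro θ h0 h1
    have hle := conjugate_combination_le hyd hsd h0.le h1
    have hwd : y' + θ • (s - y') ∈ effDom (conjugate g) := lt_of_le_of_lt hle (EReal.coe_lt_top _)
    have hm := hmin _ hwd
    rw [← coe_toReal_conjugate hwd, EReal.coe_le_coe_iff] at hle
    have e1 : y' + θ • (s - y') - (y + α • x) = θ • (s - y') - α • x' := by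
      rw [add_sub_right_comm, hu]; abel
    rw [e1, hu, norm_neg, @norm_sub_sq_real, inner_smul_left, inner_smul_right, norm_smul,
      norm_smul, Real.norm_of_nonneg h0.le, Real.norm_of_nonneg hα.le, real_inner_comm] at hm
    simp only [conj_trivial] at hm
    have hle' := mul_le_mul_of_nonneg_left hle hα.le
    have : 0 ≤ θ * (α * ((conjugate g s).toReal - (conjugate g y').toReal - ⟪x', s - y'⟫_ℝ)
        + θ * (1 / 2 * ‖s - y'‖ ^ 2)) := by nlinarith
    exact nonneg_of_mul_nonneg_right this h0
  have hlim : 0 ≤ α * ((conjugate g s).toReal - (conjugate g y').toReal - ⟪x', s - y'⟫_ℝ) := by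
    refine ge_of_tendsto (x := 𝓝[>] (0 : ℝ)) (f := fun θ : ℝ =>
      α * ((conjugate g s).toReal - (conjugate g y').toReal - ⟪x', s - y'⟫_ℝ)
        + θ * (1 / 2 * ‖s - y'‖ ^ 2)) ?_ ?_
    · refine tendsto_nhdsWithin_of_tendsto_nhds ?_
      have : Continuous fun θ : ℝ =>
        α * ((conjugate g s).toReal - (conjugate g y').toReal - ⟪x', s - y'⟫_ℝ)
          + θ * (1 / 2 * ‖s - y'‖ ^ 2) := by fun_prop
      simpa using this.tendsto 0
    · filter_upwards [Ioc_mem_nhdsGT (zero_lt_one' ℝ)] with θ h using hθ θ h.1 h.2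
  have hlim' := nonneg_of_mul_nonneg_right hlim hα
  refine mem_convexSubdiff_of_le hyd ?_
  rw [toReal_conjugate_of_mem_convexSubdiff hs, inner_sub_right] at hlim'
  linarith

/-- Along a proximal step on `g^*`, the affine minorant `⟨x, ·⟩ - g^*` of `g(x)` increases. -/
theorem inner_sub_conjugate_add_le {g : V → ℝ} {α : ℝ} {x y y' : V}
    (hy : y ∈ effDom (conjugate g)) (h : y' ∈ convexSubdiff g (x + α⁻¹ • (y - y'))) :
    ⟪x, y⟫_ℝ - (conjugate g y).toReal + α⁻¹ * ‖y' - y‖ ^ 2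
      ≤ ⟪x, y'⟫_ℝ - (conjugate g y').toReal := by
  have h1 := inner_sub_toReal_conjugate_le hy (x + α⁻¹ • (y - y'))
  rw [toReal_conjugate_of_mem_convexSubdiff h]
  have e : ‖y' - y‖ ^ 2 = ⟪y - y', y⟫_ℝ - ⟪y - y', y'⟫_ℝ := by
    rw [← inner_sub_right, norm_sub_rev, real_inner_self_eq_norm_sq]
  rw [inner_add_left, inner_smul_left] at h1 ⊢
  simp only [conj_trivial] at h1 ⊢
  rw [e, mul_sub]
  linarith

/-- If `η(x, y) > 0`, the norm of `y` is at most the value of the convex function at some point at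
distance at most one from `x`. -/
theorem norm_le_of_eta_pos {g : V → ℝ} {B : ℝ} {x y : V} (hy : y ∈ effDom (conjugate g))
    (h : 0 < ⟪x, y⟫_ℝ - (conjugate g y).toReal) (hB : ∀ u, dist u x ≤ 1 → g u ≤ B) :
    ‖y‖ ≤ B := by
  set u := x + ‖y‖⁻¹ • y with hu
  have h1 := inner_sub_toReal_conjugate_le hy u
  have h2 : g u ≤ B := by
    refine hB u ?_
    rw [dist_eq_norm, hu, add_sub_cancel_left, norm_smul, norm_inv, norm_norm]
    exact inv_mul_le_one
  have h3 : ⟪u, y⟫_ℝ = ⟪x, y⟫_ℝ + ‖y‖ := by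
    rw [hu, inner_add_left, inner_smul_left, real_inner_self_eq_norm_sq]
    simp only [conj_trivial]
    rcases eq_or_ne ‖y‖ 0 with h0 | h0
    · simp [h0]
    · field_simp
  linarith

/-- A local quadratic lower bound implies membership in the Fréchet subdifferential. -/
theorem mem_frechetSubdiff_of_quadratic {φ : V → EReal} (hbot : ∀ z, φ z ≠ ⊥) {x v : V}
    (hx : x ∈ effDom φ) {C : ℝ} (hC : ∀ᶠ w in 𝓝 x, w ∈ effDom φ →
      (φ x).toReal + ⟪v, w - x⟫_ℝ ≤ (φ w).toReal + C * ‖w - x‖ ^ 2) :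
    v ∈ frechetSubdiff φ x := by
  refine ⟨hx, ?_⟩
  have key : ∀ᶠ z in 𝓝[≠] x, ((-(C * ‖z - x‖) : ℝ) : EReal) ≤
      (φ z - φ x - ((⟪v, z - x⟫_ℝ : ℝ) : EReal)) / ((‖z - x‖ : ℝ) : EReal) := by
    filter_upwards [self_mem_nhdsWithin, mem_nhdsWithin_of_mem_nhds hC] with z hz hCz
    have hpos : 0 < ‖z - x‖ := norm_pos_iff.2 (sub_ne_zero.2 hz)
    rw [← EReal.coe_toReal (ne_of_lt hx) (hbot x)]
    by_cases hzd : z ∈ effDom φ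
    · rw [← EReal.coe_toReal (ne_of_lt hzd) (hbot z), ← EReal.coe_sub, ← EReal.coe_sub,
        ← EReal.coe_div, EReal.coe_le_coe_iff, le_div_iff₀ hpos]
      have := hCz hzd
      nlinarith
    · have htop : φ z = ⊤ := not_lt_top_iff.1 hzd
      rw [htop, EReal.top_sub_coe, EReal.top_sub_coe,
        EReal.top_div_of_pos_ne_top (by exact_mod_cast hpos) (EReal.coe_ne_top _)]
      exact le_top
  have hlim : Tendsto (fun z => ((-(C * ‖z - x‖) : ℝ) : EReal)) (𝓝[≠] x) (𝓝 0) := by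
    refine tendsto_nhdsWithin_of_tendsto_nhds ?_
    have hcont : Continuous fun z : V => ((-(C * ‖z - x‖) : ℝ) : EReal) :=
      continuous_coe_real_ereal.comp (by fun_prop)
    simpa using hcont.tendsto x
  rcases (𝓝[≠] x).eq_or_neBot with hb | hb
  · simp [hb, liminf_bot]
  · rw [← hlim.liminf_eq]
    exact liminf_le_liminf key

end ConvexTools

/-! ### A converse Borel–Cantelli argument -/

/-- Let `G t` be known at time `t` and let `A t` have conditional probability at least `p > 0` at
time `t`. If almost surely `G t ∩ A t` occurs only finitely often, then so does `G t`. The events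
`A t` need not become known at any later time, so the second Borel–Cantelli lemma for filtrations
does not apply; instead, the set on which `G` occurs after time `T` is split according to the
first such occurrence. -/
theorem ae_eventually_notMem_of_le_measure_inter {S : Type*} {mS : MeasurableSpace S}
    {μ : Measure S} [IsProbabilityMeasure μ] {ℱ : Filtration ℕ mS} {p : ENNReal} (hp : p ≠ 0)
    {A G : ℕ → Set S} (hA : ∀ t, MeasurableSet (A t))
    (hpA : ∀ t s, MeasurableSet[ℱ t] s → p * μ s ≤ μ (s ∩ A t))
    (hG : ∀ t, MeasurableSet[ℱ t] (G t))
    (h : ∀ᵐ ω ∂μ, ∀ᶠ t in atTop, ω ∈ G t → ω ∉ A t) :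
    ∀ᵐ ω ∂μ, ∀ᶠ t in atTop, ω ∉ G t := by
  have hG' : ∀ t, MeasurableSet (G t) := fun t => ℱ.le t _ (hG t)
  let D : ℕ → Set S := fun T => ⋃ t ≥ T, G t ∩ A t
  have hDmeas : ∀ T, MeasurableSet (D T) := fun T =>
    MeasurableSet.iUnion fun t => MeasurableSet.iUnion fun _ => (hG' t).inter (hA t)
  have hDanti : Antitone D := fun T T' hT =>
    Set.biUnion_subset_biUnion_left fun t (ht : T' ≤ t) => hT.trans ht
  have hD0 : Tendsto (fun T => μ (D T)) atTop (𝓝 0) := by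
    have hlim := tendsto_measure_iInter_atTop (μ := μ) (s := D)
      (fun T => (hDmeas T).nullMeasurableSet) hDanti ⟨0, measure_ne_top _ _⟩
    have hz : μ (⋂ T, D T) = 0 := by
      refine measure_mono_null ?_ (ae_iff.1 h)
      intro ω hω hcon
      obtain ⟨T, hT⟩ := eventually_atTop.1 hcon
      obtain ⟨t, hGt, htT, hAt⟩ : ∃ t, ω ∈ G t ∧ T ≤ t ∧ ω ∈ A t := by
        simpa [D] using Set.mem_iInter.1 hω T
      exact hT t htT hGt hAt
    rw [hz] at hlim
    exact hlim
  have hbound : ∀ T, p * μ (⋃ k, G (T + k)) ≤ μ (D T) := by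
    intro T
    let E : ℕ → Set S := disjointed fun k => G (T + k)
    have hE : ∀ k, MeasurableSet[ℱ (T + k)] (E k) := by
      intro k
      have hEk : E k = G (T + k) \ ⋃ j ∈ Finset.range k, G (T + j) := by
        simp only [E, disjointed_apply, Finset.sup_set_eq_biUnion]
        ext ω
        simp
      rw [hEk]
      refine MeasurableSet.diff (hG _) (Finset.measurableSet_biUnion _ fun j hj => ?_)
      exact ℱ.mono (Nat.add_le_add_left (Finset.mem_range.1 hj).le T) _ (hG (T + j))
    have hEdisj : Pairwise (Function.onFun Disjoint E) := disjoint_disjointed _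
    have hE' : ∀ k, MeasurableSet (E k) := fun k => ℱ.le _ _ (hE k)
    calc p * μ (⋃ k, G (T + k)) = ∑' k, p * μ (E k) := by
          rw [ENNReal.tsum_mul_left, ← measure_iUnion hEdisj hE', iUnion_disjointed]
      _ ≤ ∑' k, μ (E k ∩ A (T + k)) := ENNReal.tsum_le_tsum fun k => hpA _ _ (hE k)
      _ = μ (⋃ k, E k ∩ A (T + k)) := by
          refine (measure_iUnion (fun i j hij => ?_) fun k => (hE' k).inter (hA _)).symm
          exact (hEdisj hij).mono Set.inter_subset_left Set.inter_subset_left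
      _ ≤ μ (D T) := by
          refine measure_mono (Set.iUnion_subset fun k ω hω => ?_)
          have hGk : ω ∈ G (T + k) := disjointed_subset (fun k => G (T + k)) k hω.1
          simp only [D, Set.mem_iUnion]
          exact ⟨T + k, Nat.le_add_right T k, hGk, hω.2⟩
  rw [ae_iff]
  set H := {ω | ¬ ∀ᶠ t in atTop, ω ∉ G t}
  have hH : ∀ T, p * μ H ≤ μ (D T) := by
    intro T
    refine le_trans ?_ (hbound T)
    gcongr
    intro ω hω
    have hω' : ∃ᶠ t in atTop, ω ∈ G t := hω
    obtain ⟨t, ht, hGt⟩ := frequently_atTop.1 hω' T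
    refine Set.mem_iUnion.2 ⟨t - T, ?_⟩
    rwa [Nat.add_sub_cancel' ht]
  have h0 : p * μ H ≤ 0 := ge_of_tendsto' hD0 hH
  simpa [hp] using h0

/-- A lower bound on the conditional probability of `A`, integrated over events `s` of the
conditioning σ-algebra. -/
theorem ofReal_mul_measure_le_measure_inter {S : Type*} {m mS : MeasurableSpace S}
    {μ : Measure S} [IsProbabilityMeasure μ] (hm : m ≤ mS) {p : ℝ} {A : Set S}
    (hA : MeasurableSet A) (hpA : ∀ᵐ ω ∂μ, p ≤ (μ⟦A | m⟧) ω) {s : Set S}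
    (hs : MeasurableSet[m] s) : ENNReal.ofReal p * μ s ≤ μ (s ∩ A) := by
  have hint : Integrable (A.indicator fun _ => (1 : ℝ)) μ := (integrable_const 1).indicator hA
  have h1 : ∫ ω in s, (μ⟦A | m⟧) ω ∂μ = μ.real (s ∩ A) := by
    rw [setIntegral_condExp hm hint hs, setIntegral_indicator hA]
    simp
  have h2 : p * μ.real s ≤ ∫ ω in s, (μ⟦A | m⟧) ω ∂μ := by
    have h3 : ∫ _ in s, p ∂μ ≤ ∫ ω in s, (μ⟦A | m⟧) ω ∂μ :=
      setIntegral_mono_ae (integrable_const p).integrableOn integrable_condExp.integrableOn hpA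
    simpa [mul_comm] using h3
  rw [h1] at h2
  rw [← ENNReal.ofReal_toReal (measure_ne_top μ s),
    ← ENNReal.ofReal_toReal (measure_ne_top μ (s ∩ A)), ← ENNReal.ofReal_mul' ENNReal.toReal_nonneg]
  exact ENNReal.ofReal_le_ofReal h2

/-! ### Nonmonotone descent -/

/-- The argument of Grippo, Lampariello and Lucidi in abstract form. The sequence `ψ` is
asymptotically nonpositive, every window of length `M + 1` contains a time at which it is
nonnegative, and near-nonnegativity propagates one step backwards in time; then `ψ → 0`. -/
theorem tendsto_zero_of_window_nonneg {ψ : ℕ → ℝ} (M : ℕ) (hup : ∀ ε > 0, ∀ᶠ t in atTop, ψ t ≤ ε)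
    (hwin : ∀ t, ∃ j ≤ M, 0 ≤ ψ (t + j))
    (hback : ∀ ε > 0, ∃ δ > 0, ∀ᶠ t in atTop, -δ ≤ ψ (t + 1) → -ε ≤ ψ t) :
    Tendsto ψ atTop (𝓝 0) := by
  have hj : ∀ j : ℕ, ∀ ε > 0, ∃ δ > 0, ∀ᶠ t in atTop, -δ ≤ ψ (t + j) → -ε ≤ ψ t := by
    intro j
    induction j with
    | zero => exact fun ε hε => ⟨ε, hε, Eventually.of_forall fun t ht => ht⟩
    | succ j ih =>
      intro ε hε
      obtain ⟨δ, hδ, h1⟩ := ih ε hε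
      obtain ⟨δ', hδ', h2⟩ := hback δ hδ
      refine ⟨δ', hδ', ?_⟩
      filter_upwards [h1, (tendsto_add_atTop_nat j).eventually h2] with t ha hb hc
      exact ha (hb hc)
  rw [Metric.tendsto_nhds]
  intro ε hε
  have hlow : ∀ᶠ t in atTop, ∀ j ∈ Finset.range (M + 1), 0 ≤ ψ (t + j) → -(ε / 2) ≤ ψ t := by
    rw [Filter.eventually_all_finset]
    intro j _
    obtain ⟨δ, hδ, h1⟩ := hj j (ε / 2) (half_pos hε)
    filter_upwards [h1] with t ht h0
    exact ht (by linarith)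
  filter_upwards [hlow, hup (ε / 2) (half_pos hε)] with t h1 h2
  obtain ⟨j, hjM, hj0⟩ := hwin t
  have h3 := h1 j (Finset.mem_range.2 (by omega)) hj0
  rw [Real.dist_eq, sub_zero, abs_lt]
  constructor <;> linarith

/-! ### Block vectors -/

section Blocks

variable {n N : ℕ} {blk : Fin n → Fin N}

theorem continuous_subvec (i : Fin N) : Continuous (subvec blk i) :=
  (PiLp.continuous_toLp 2 _).comp
    (continuous_pi fun j => (continuous_apply j.1).comp (PiLp.continuous_ofLp 2 _))

theorem subvec_sub (i : Fin N) (x y : Rn n) :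
    subvec blk i (x - y) = subvec blk i x - subvec blk i y := by
  ext j; simp [subvec]

theorem subvec_smul (i : Fin N) (r : ℝ) (x : Rn n) :
    subvec blk i (r • x) = r • subvec blk i x := by
  ext j; simp [subvec]

theorem subvec_replaceBlock_self (i : Fin N) (x : Rn n) (z : BlockSpace blk i) :
    subvec blk i (replaceBlock blk i x z) = z := by
  ext ⟨j, hj⟩
  simp [subvec, replaceBlock, hj]

theorem subvec_replaceBlock_of_ne {i k : Fin N} (h : k ≠ i) (x : Rn n) (z : BlockSpace blk i) :
    subvec blk k (replaceBlock blk i x z) = subvec blk k x := by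
  ext ⟨j, hj⟩
  have : blk j ≠ i := by rw [hj]; exact h
  simp [subvec, replaceBlock, this]

theorem inner_eq_sum_subvec (x y : Rn n) :
    ⟪x, y⟫_ℝ = ∑ i, ⟪subvec blk i x, subvec blk i y⟫_ℝ := by
  simp only [PiLp.inner_apply, subvec]
  rw [← Finset.sum_fiberwise Finset.univ blk]
  refine Finset.sum_congr rfl fun i _ => ?_
  rw [Finset.sum_subtype (p := fun j => blk j = i) _ (by simp)]

theorem norm_sq_eq_sum_subvec (x : Rn n) : ‖x‖ ^ 2 = ∑ i, ‖subvec blk i x‖ ^ 2 := by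
  simp only [← real_inner_self_eq_norm_sq]
  exact inner_eq_sum_subvec x x

theorem inner_replaceBlock_sub (i : Fin N) (v x : Rn n) (z : BlockSpace blk i) :
    ⟪v, replaceBlock blk i x z - x⟫_ℝ = ⟪subvec blk i v, z - subvec blk i x⟫_ℝ := by
  rw [inner_eq_sum_subvec (blk := blk), Finset.sum_eq_single i]
  · rw [subvec_sub, subvec_replaceBlock_self]
  · intro k _ hk
    rw [subvec_sub, subvec_replaceBlock_of_ne hk, sub_self, inner_zero_right]
  · simp

theorem norm_replaceBlock_sub (i : Fin N) (x : Rn n) (z : BlockSpace blk i) :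
    ‖replaceBlock blk i x z - x‖ = ‖z - subvec blk i x‖ := by
  have h : ‖replaceBlock blk i x z - x‖ ^ 2 = ‖z - subvec blk i x‖ ^ 2 := by
    rw [← real_inner_self_eq_norm_sq, inner_replaceBlock_sub, subvec_sub, subvec_replaceBlock_self,
      real_inner_self_eq_norm_sq]
  exact (sq_eq_sq₀ (norm_nonneg _) (norm_nonneg _)).1 h

end Blocks

/-! ### Real-valued forms of the objective functions -/

theorem LowerSemicontinuous.measurable_ereal {X : Type*} [TopologicalSpace X] [MeasurableSpace X]
    [BorelSpace X] {φ : X → EReal} (h : LowerSemicontinuous φ) : Measurable φ :=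
  measurable_of_Ioi fun r => (h.isOpen_preimage r).measurableSet

namespace FracProblem

variable {n N : ℕ} (P : FracProblem n N)

/-- The real-valued form of `f`; it equals `f` on `dom f`. -/
noncomputable def fReal (x : Rn n) : ℝ := ∑ i, (P.fi i (subvec P.blk i x)).toReal

/-- The real-valued form of `ζ`; it equals `ζ` on `Ω ∩ dom f`. -/
noncomputable def zetaReal (x : Rn n) : ℝ := P.fReal x + (P.h x).toReal

/-- The real-valued form of `η`; it equals `η` for `y ∈ dom g^*`. -/
noncomputable def etaReal (x y : Rn n) : ℝ := ⟪x, y⟫_ℝ - (conjugate P.g y).toReal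

/-- The gradient direction `∇h(x) - Q(x, y) y` used in the `x`-updates. -/
noncomputable def direction (x y : Rn n) : Rn n :=
  P.gradh x - (P.zetaReal x / P.etaReal x y) • y

theorem etaReal_sub (x x' y : Rn n) : P.etaReal x' y - P.etaReal x y = ⟪x' - x, y⟫_ℝ := by
  simp only [etaReal, inner_sub_left]; ring

theorem etaReal_le_g {y : Rn n} (hy : y ∈ effDom (conjugate P.g)) (x : Rn n) :
    P.etaReal x y ≤ P.g x :=
  inner_sub_toReal_conjugate_le hy x

theorem eta_eq_coe {y : Rn n} (hy : y ∈ effDom (conjugate P.g)) (x : Rn n) :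
    P.eta x y = (P.etaReal x y : EReal) := by
  rw [eta, ← coe_toReal_conjugate hy, ← EReal.coe_sub, etaReal]

theorem measurable_gradh : Measurable P.gradh :=
  (InnerProductSpace.toDual ℝ (Rn n)).symm.continuous.measurable.comp (measurable_fderiv ℝ _)

theorem measurable_etaReal : Measurable fun z : Rn n × Rn n => P.etaReal z.1 z.2 := by
  have hlsc : LowerSemicontinuous (conjugate P.g) :=
    lowerSemicontinuous_iSup fun x => Continuous.lowerSemicontinuous
      (continuous_coe_real_ereal.comp (by fun_prop))
  exact (continuous_fst.inner continuous_snd).measurable.sub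
    (measurable_ereal_toReal.comp (hlsc.measurable_ereal.comp measurable_snd))

theorem mem_Omega_of_etaReal_pos {x y : Rn n} (hy : y ∈ effDom (conjugate P.g))
    (h : 0 < P.etaReal x y) : x ∈ P.Omega :=
  (h.trans_le (P.etaReal_le_g hy x)).ne'

namespace Standing

variable {P} (hP : P.Standing)
include hP

theorem continuous_g : Continuous P.g := hP.g_convex.locallyLipschitz.continuous

theorem isOpen_Omega : IsOpen P.Omega := isOpen_ne_fun hP.continuous_g continuous_const

theorem g_pos {x : Rn n} (hx : x ∈ P.Omega) : 0 < P.g x :=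
  lt_of_le_of_ne (hP.g_nonneg x) (Ne.symm hx)

theorem f_ne_bot (x : Rn n) : P.f x ≠ ⊥ := by
  rw [← bot_lt_iff_ne_bot, f]
  exact Finset.sum_induction _ (fun a => ⊥ < a) (fun a b ha hb => EReal.bot_lt_add_iff.2 ⟨ha, hb⟩)
    EReal.bot_lt_zero fun i _ => bot_lt_iff_ne_bot.2 (hP.fi_ne_bot i _)

theorem mem_effDom_f_iff {x : Rn n} :
    x ∈ effDom P.f ↔ ∀ i, subvec P.blk i x ∈ effDom (P.fi i) := by
  constructor
  · intro hx i
    by_contra hi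
    have htop : P.fi i (subvec P.blk i x) = ⊤ := not_lt_top_iff.1 hi
    have hrest : ⊥ < ∑ j ∈ Finset.univ.erase i, P.fi j (subvec P.blk j x) :=
      Finset.sum_induction _ (fun a => ⊥ < a) (fun a b ha hb => EReal.bot_lt_add_iff.2 ⟨ha, hb⟩)
        EReal.bot_lt_zero fun j _ => bot_lt_iff_ne_bot.2 (hP.fi_ne_bot j _)
    have : P.f x = ⊤ := by
      rw [f, ← Finset.add_sum_erase _ _ (Finset.mem_univ i), htop,
        EReal.top_add_of_ne_bot hrest.ne']
    exact absurd hx (by simp [effDom, this])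
  · intro hx
    exact Finset.sum_induction _ (fun a => a < (⊤ : EReal)) (fun a b ha hb => EReal.add_lt_top
      ha.ne hb.ne) EReal.zero_lt_top fun i _ => hx i

theorem f_eq_coe {x : Rn n} (hx : x ∈ effDom P.f) : P.f x = (P.fReal x : EReal) := by
  have h : ∀ i, P.fi i (subvec P.blk i x) = (((P.fi i (subvec P.blk i x)).toReal : ℝ) : EReal) :=
    fun i => (EReal.coe_toReal (ne_of_lt (hP.mem_effDom_f_iff.1 hx i)) (hP.fi_ne_bot i _)).symm
  have hsum : ∀ s : Finset (Fin N), ∑ i ∈ s, P.fi i (subvec P.blk i x)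
      = ((∑ i ∈ s, (P.fi i (subvec P.blk i x)).toReal : ℝ) : EReal) := by
    intro s
    induction s using Finset.cons_induction with
    | empty => simp
    | cons a s ha ih => rw [Finset.sum_cons, Finset.sum_cons, EReal.coe_add, ih, ← h a]
  exact hsum Finset.univ

theorem toReal_f {x : Rn n} (hx : x ∈ effDom P.f) : (P.f x).toReal = P.fReal x := by
  rw [hP.f_eq_coe hx, EReal.toReal_coe]

theorem zeta_eq_coe {x : Rn n} (hx : x ∈ effDom P.f) (hΩ : x ∈ P.Omega) :
    P.zeta x = (P.zetaReal x : EReal) := by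
  rw [zeta, hP.f_eq_coe hx, zetaReal, EReal.coe_add,
    EReal.coe_toReal (hP.h_finite x hΩ) (hP.h_ne_bot x)]

theorem zetaReal_nonneg {x : Rn n} (hx : x ∈ effDom P.f) (hΩ : x ∈ P.Omega) :
    0 ≤ P.zetaReal x := by
  have h := hP.zeta_nonneg x hx
  rw [hP.zeta_eq_coe hx hΩ] at h
  exact_mod_cast h

theorem Q_eq_coe {x y : Rn n} (hx : x ∈ effDom P.f) (hy : y ∈ effDom (conjugate P.g))
    (h : 0 < P.etaReal x y) : P.Q x y = ((P.zetaReal x / P.etaReal x y : ℝ) : EReal) := by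
  have h' : 0 < P.eta x y := by rw [P.eta_eq_coe hy]; exact_mod_cast h
  rw [Q, if_pos ⟨hx, hy, h'⟩, P.eta_eq_coe hy,
    hP.zeta_eq_coe hx (P.mem_Omega_of_etaReal_pos hy h), ← EReal.coe_div]

theorem mem_effDom_F_iff {x : Rn n} : x ∈ effDom P.F ↔ x ∈ P.Omega ∧ x ∈ effDom P.f := by
  constructor
  · intro hx
    by_contra hcon
    have : P.F x = ⊤ := if_neg hcon
    exact absurd hx (by simp [effDom, this])
  · intro hx
    change P.F x < ⊤
    rw [F, if_pos (show x ∈ P.Omega ∩ effDom P.f from hx), hP.zeta_eq_coe hx.2 hx.1,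
      ← EReal.coe_div]
    exact EReal.coe_lt_top _

theorem F_eq_coe {x : Rn n} (hx : x ∈ effDom P.f) (hΩ : x ∈ P.Omega) :
    P.F x = ((P.zetaReal x / P.g x : ℝ) : EReal) := by
  rw [F, if_pos ⟨hΩ, hx⟩, hP.zeta_eq_coe hx hΩ, ← EReal.coe_div]

theorem continuousOn_fReal : ContinuousOn P.fReal (effDom P.f) := by
  have h : ContinuousOn (fun x => (P.f x).toReal) (effDom P.f) := fun x hx =>
    ((EReal.tendsto_toReal (ne_of_lt hx) (hP.f_ne_bot x)).comp (hP.f_continuousOn x hx))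
  exact h.congr fun x hx => (hP.toReal_f hx).symm

theorem continuousOn_zetaReal : ContinuousOn P.zetaReal (effDom P.f ∩ P.Omega) :=
  (hP.continuousOn_fReal.mono Set.inter_subset_left).add fun x hx =>
    (hP.h_differentiable x hx.2).continuousAt.continuousWithinAt

theorem continuousOn_gradh : ContinuousOn P.gradh P.Omega := by
  intro x hx
  obtain ⟨U, hU, L, hL⟩ := hP.gradh_locallyLipschitz x hx
  refine ContinuousAt.continuousWithinAt ?_
  rw [ContinuousAt, tendsto_iff_norm_sub_tendsto_zero]
  have hlim : Tendsto (fun u => L * ‖u - x‖) (𝓝 x) (𝓝 0) := by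
    have hc : Continuous fun u : Rn n => L * ‖u - x‖ := by fun_prop
    simpa using hc.tendsto x
  refine squeeze_zero' (Eventually.of_forall fun u => norm_nonneg _) ?_ hlim
  filter_upwards [hU, hP.isOpen_Omega.mem_nhds hx] with u hu hu'
  exact hL u ⟨hu, hu'⟩ x ⟨mem_of_mem_nhds hU, hx⟩

theorem measurable_fi_toReal (i : Fin N) : Measurable fun z => (P.fi i z).toReal :=
  measurable_ereal_toReal.comp (hP.fi_lsc i).measurable_ereal

theorem measurable_fReal : Measurable P.fReal :=
  Finset.measurable_fun_sum _ fun i _ =>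
    (hP.measurable_fi_toReal i).comp (continuous_subvec i).measurable

theorem measurable_zetaReal : Measurable P.zetaReal :=
  hP.measurable_fReal.add (measurable_ereal_toReal.comp hP.h_lsc.measurable_ereal)

theorem measurable_direction : Measurable fun z : Rn n × Rn n => P.direction z.1 z.2 :=
  (P.measurable_gradh.comp measurable_fst).sub
    (((hP.measurable_zetaReal.comp measurable_fst).div P.measurable_etaReal).smul measurable_snd)

end Standing

end FracProblem

/-! ### Uniform bounds on compact sets -/

namespace FracProblem

variable {n N : ℕ} (P : FracProblem n N)

/-- The pairs `(x, y)` at which `Q` is finite. -/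
structure Admissible (x y : Rn n) : Prop where
  mem_dom_f : x ∈ effDom P.f
  mem_dom_conj : y ∈ effDom (conjugate P.g)
  eta_pos : 0 < P.etaReal x y

theorem Admissible.mem_Omega {P : FracProblem n N} {x y : Rn n} (h : P.Admissible x y) :
    x ∈ P.Omega :=
  P.mem_Omega_of_etaReal_pos h.mem_dom_conj h.eta_pos

theorem fReal_replaceBlock (i : Fin N) (x : Rn n) (z : BlockSpace P.blk i) :
    P.fReal (replaceBlock P.blk i x z) - P.fReal x
      = (P.fi i z).toReal - (P.fi i (subvec P.blk i x)).toReal := by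
  rw [fReal, fReal, ← Finset.sum_sub_distrib, Finset.sum_eq_single i]
  · rw [subvec_replaceBlock_self]
  · intro k _ hk
    rw [subvec_replaceBlock_of_ne hk, sub_self]
  · simp

namespace Standing

variable {P} (hP : P.Standing)
include hP

theorem replaceBlock_mem_dom {i : Fin N} {x : Rn n} {z : BlockSpace P.blk i}
    (hx : x ∈ effDom P.f) (hz : z ∈ effDom (P.fi i)) :
    replaceBlock P.blk i x z ∈ effDom P.f := by
  rw [hP.mem_effDom_f_iff] at hx ⊢
  intro k
  rcases eq_or_ne k i with rfl | hk
  · rwa [subvec_replaceBlock_self]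
  · rw [subvec_replaceBlock_of_ne hk]; exact hx k

/-- The second-order upper bound on `h` holds with uniform constants along a compact subset of
`Ω`. -/
theorem exists_uniform_descent {X : Set (Rn n)} (hX : IsCompact X) (hXΩ : X ⊆ P.Omega) :
    ∃ L ≥ 0, ∃ δ > 0, ∀ x ∈ X, ∀ u, ‖u - x‖ ≤ δ → u ∈ P.Omega ∧
      (P.h u).toReal ≤ (P.h x).toReal + ⟪P.gradh x, u - x⟫_ℝ + L * ‖u - x‖ ^ 2 := by
  refine hX.induction_on (p := fun s => ∃ L ≥ 0, ∃ δ > 0, ∀ x ∈ s, ∀ u, ‖u - x‖ ≤ δ →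
      u ∈ P.Omega ∧
      (P.h u).toReal ≤ (P.h x).toReal + ⟪P.gradh x, u - x⟫_ℝ + L * ‖u - x‖ ^ 2) ?_ ?_ ?_ ?_
  · exact ⟨0, le_rfl, 1, one_pos, fun x hx => absurd hx (Set.notMem_empty x)⟩
  · rintro s t hst ⟨L, hL, δ, hδ, h⟩
    exact ⟨L, hL, δ, hδ, fun x hx => h x (hst hx)⟩
  · rintro s t ⟨L, hL, δ, hδ, h⟩ ⟨L', hL', δ', hδ', h'⟩
    refine ⟨max L L', le_max_of_le_left hL, min δ δ', lt_min hδ hδ', ?_⟩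
    rintro x (hx | hx) u hu
    · obtain ⟨h1, h2⟩ := h x hx u (hu.trans (min_le_left _ _))
      refine ⟨h1, h2.trans ?_⟩
      gcongr
      exact le_max_left _ _
    · obtain ⟨h1, h2⟩ := h' x hx u (hu.trans (min_le_right _ _))
      refine ⟨h1, h2.trans ?_⟩
      gcongr
      exact le_max_right _ _
  · intro x hx
    obtain ⟨U, hU, L, hL⟩ := hP.gradh_locallyLipschitz x (hXΩ hx)
    obtain ⟨ε, hε, hball⟩ := Metric.mem_nhds_iff.1
      (inter_mem hU (hP.isOpen_Omega.mem_nhds (hXΩ hx)))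
    refine ⟨Metric.ball x (ε / 2), mem_nhdsWithin_of_mem_nhds
      (Metric.ball_mem_nhds x (half_pos hε)), max L 0, le_max_right _ _, ε / 4, by positivity,
      fun v hv u hu => ?_⟩
    have hv' : v ∈ Metric.ball x ε := Metric.ball_subset_ball (by linarith) hv
    have hu' : u ∈ Metric.ball x ε := by
      rw [Metric.mem_ball] at hv ⊢
      have := dist_triangle u v x
      rw [dist_eq_norm u v] at this
      linarith
    have hseg : segment ℝ v u ⊆ Metric.ball x ε := (convex_ball x ε).segment_subset hv' hu'
    refine ⟨(hball hu').2, ?_⟩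
    have hmv := (convex_segment (𝕜 := ℝ) v u).norm_image_sub_le_of_norm_fderiv_le'
      (f := fun z => (P.h z).toReal) (φ := fderiv ℝ (fun z => (P.h z).toReal) v)
      (C := max L 0 * ‖u - v‖) (fun z hz => hP.h_differentiable z (hball (hseg hz)).2) ?_
      (left_mem_segment ℝ v u) (right_mem_segment ℝ v u)
    · have hg : fderiv ℝ (fun z => (P.h z).toReal) v (u - v) = ⟪P.gradh v, u - v⟫_ℝ := by
        rw [gradh, gradient, InnerProductSpace.toDual_symm_apply]
      rw [hg] at hmv
      have := (le_abs_self _).trans hmv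
      nlinarith
    · intro z hz
      have h1 : ‖fderiv ℝ (fun z => (P.h z).toReal) z - fderiv ℝ (fun z => (P.h z).toReal) v‖
          = ‖P.gradh z - P.gradh v‖ := by
        rw [gradh, gradh, gradient, gradient, ← map_sub, LinearIsometryEquiv.norm_map]
      have h2 : ‖z - v‖ ≤ ‖u - v‖ := norm_sub_le_of_mem_segment hz
      rw [h1]
      calc _ ≤ L * ‖z - v‖ := hL z (hball (hseg hz)) v (hball hv')
        _ ≤ max L 0 * ‖z - v‖ := by gcongr; exact le_max_left _ _
        _ ≤ _ := by gcongr

/-- The vectors `y` with `η(x, y) > 0` are bounded, uniformly for `x` in a compact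
set. -/
theorem exists_norm_bound {X : Set (Rn n)} (hX : IsCompact X) :
    ∃ B ≥ 0, ∀ x ∈ X, ∀ y ∈ effDom (conjugate P.g), 0 < P.etaReal x y → ‖y‖ ≤ B := by
  obtain ⟨B, hB⟩ := (hX.cthickening (r := 1)).bddAbove_image hP.continuous_g.continuousOn
  refine ⟨max B 0, le_max_right _ _, fun x hx y hy h => (norm_le_of_eta_pos hy h ?_).trans
    (le_max_left _ _)⟩
  intro u hu
  exact hB ⟨u, Metric.mem_cthickening_of_dist_le u x 1 X hx hu, rfl⟩

/-- The possible decrease of a single block function is bounded, uniformly on a compact subset of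
`dom f`. -/
theorem exists_block_bound {X : Set (Rn n)} (hX : IsCompact X) (hXf : X ⊆ effDom P.f) :
    ∃ C ≥ 0, ∀ x ∈ X, ∀ i, ∀ z ∈ effDom (P.fi i),
      (P.fi i (subvec P.blk i x)).toReal - (P.fi i z).toReal ≤ C := by
  choose m hm using hP.fi_bddBelow
  have hm' : ∀ i, ∀ z ∈ effDom (P.fi i), m i ≤ (P.fi i z).toReal := by
    intro i z hz
    have h := hm i z
    rw [← EReal.coe_toReal (ne_of_lt hz) (hP.fi_ne_bot i z)] at h
    exact_mod_cast h
  obtain ⟨A, hA⟩ := hX.bddAbove_image (hP.continuousOn_fReal.mono hXf)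
  refine ⟨max (A - ∑ i, m i) 0, le_max_right _ _, fun x hx i z hz => le_max_of_le_left ?_⟩
  have h1 : P.fReal x ≤ A := hA ⟨x, hx, rfl⟩
  have h2 : (P.fi i (subvec P.blk i x)).toReal - m i
      ≤ ∑ k, ((P.fi k (subvec P.blk k x)).toReal - m k) :=
    Finset.single_le_sum (f := fun k => (P.fi k (subvec P.blk k x)).toReal - m k)
      (fun k _ => sub_nonneg.2 (hm' k _ (hP.mem_effDom_f_iff.1 (hXf hx) k))) (Finset.mem_univ i)
  rw [Finset.sum_sub_distrib] at h2
  have h3 := hm' i z hz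
  rw [fReal] at h1
  linarith

/-- The directions `∇h(x) - Q(x, y) y` are bounded as long as `x` stays in a compact set and
`Q(x, y)` stays bounded. -/
theorem exists_direction_bound {X : Set (Rn n)} (hX : IsCompact X) (hXΩ : X ⊆ P.Omega) (K : ℝ) :
    ∃ V ≥ 0, ∀ x ∈ X, ∀ y, P.Admissible x y → P.zetaReal x / P.etaReal x y ≤ K →
      ‖P.direction x y‖ ≤ V := by
  obtain ⟨B, hB0, hB⟩ := hP.exists_norm_bound hX
  obtain ⟨H, hH⟩ := hX.exists_bound_of_continuousOn (hP.continuousOn_gradh.mono hXΩ)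
  refine ⟨max (H + K * B) 0, le_max_right _ _, fun x hx y hxy hK => le_max_of_le_left ?_⟩
  have hq : 0 ≤ P.zetaReal x / P.etaReal x y :=
    div_nonneg (hP.zetaReal_nonneg hxy.mem_dom_f hxy.mem_Omega) hxy.eta_pos.le
  calc ‖P.direction x y‖ ≤ ‖P.gradh x‖ + ‖(P.zetaReal x / P.etaReal x y) • y‖ := norm_sub_le _ _
    _ = ‖P.gradh x‖ + P.zetaReal x / P.etaReal x y * ‖y‖ := by
        rw [norm_smul, Real.norm_of_nonneg hq]
    _ ≤ H + K * B := by
        gcongr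
        · exact hH x hx
        · exact hq.trans hK
        · exact hB x hx y hxy.mem_dom_conj hxy.eta_pos

/-! ### The steps of the algorithm -/

/-- A trial subvector minimizes a proximal model of the objective in the `i`-th block. -/
theorem trialSet_optimal {i : Fin N} {α : ℝ} (hα : 0 < α) {x y : Rn n} (hxy : P.Admissible x y)
    {z : BlockSpace P.blk i} (hz : z ∈ P.trialSet i α x y) :
    z ∈ effDom (P.fi i) ∧ ∀ w ∈ effDom (P.fi i),
      (P.fi i z).toReal + (2 * α)⁻¹ * ‖z - subvec P.blk i x‖ ^ 2
          + ⟪subvec P.blk i (P.direction x y), z - subvec P.blk i x⟫_ℝ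
        ≤ (P.fi i w).toReal + (2 * α)⁻¹ * ‖w - subvec P.blk i x‖ ^ 2
          + ⟪subvec P.blk i (P.direction x y), w - subvec P.blk i x⟫_ℝ := by
  obtain ⟨hzd, hmin⟩ := mem_prox_mul_real (hP.fi_ne_bot i) hα
    (hP.mem_effDom_f_iff.1 hxy.mem_dom_f i) hz
  refine ⟨hzd, fun w hw => ?_⟩
  have h := hmin w hw
  have hu : subvec P.blk i x - α • subvec P.blk i (P.gradh x)
      + (α * (P.Q x y).toReal) • subvec P.blk i y
      = subvec P.blk i x - α • subvec P.blk i (P.direction x y) := by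
    rw [hP.Q_eq_coe hxy.mem_dom_f hxy.mem_dom_conj hxy.eta_pos, EReal.toReal_coe, direction,
      subvec_sub, subvec_smul, smul_sub, smul_smul]
    abel
  have hexp : ∀ v : BlockSpace P.blk i,
      ‖v - (subvec P.blk i x - α • subvec P.blk i (P.direction x y))‖ ^ 2
        = ‖v - subvec P.blk i x‖ ^ 2
          + 2 * α * ⟪subvec P.blk i (P.direction x y), v - subvec P.blk i x⟫_ℝ
          + ‖α • subvec P.blk i (P.direction x y)‖ ^ 2 := by
    intro v
    rw [sub_sub_eq_add_sub, add_sub_right_comm, norm_add_sq_real, inner_smul_right,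
      real_inner_comm]
    ring
  rw [hu, hexp z, hexp w] at h
  have hα2 : (2 * α)⁻¹ * α = 1 / 2 := by field_simp
  refine le_of_mul_le_mul_left ?_ hα
  linear_combination h + (‖z - subvec P.blk i x‖ ^ 2 - ‖w - subvec P.blk i x‖ ^ 2) * hα2

/-- Real-valued form of a successful line-search step. -/
theorem lineSearchTest_real {c : MPGAParams} {i : Fin N} {r : ℝ} (hr : 0 ≤ r)
    {x y : Rn n} (hxy : P.Admissible x y) {z : BlockSpace P.blk i} (hz : z ∈ effDom (P.fi i))
    (h : P.LineSearchTest c r i x y z) :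
    P.Admissible (replaceBlock P.blk i x z) y ∧
      P.zetaReal (replaceBlock P.blk i x z) + c.σ / 2 * ‖replaceBlock P.blk i x z - x‖ ^ 2
        ≤ r * P.etaReal (replaceBlock P.blk i x z) y := by
  have hx' := hP.replaceBlock_mem_dom hxy.mem_dom_f hz
  set x' := replaceBlock P.blk i x z with hx'def
  rw [LineSearchTest, ← hx'def, P.eta_eq_coe hxy.mem_dom_conj, ← EReal.coe_mul] at h
  have hη : 0 < P.etaReal x' y := by
    rcases eq_or_ne x' x with heq | hne
    · rw [heq]; exact hxy.eta_pos
    · have hpos : 0 < c.σ / 2 * ‖x' - x‖ ^ 2 := by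
        have := norm_pos_iff.2 (sub_ne_zero.2 hne)
        have := c.σ_pos
        positivity
      have h1 : ((c.σ / 2 * ‖x' - x‖ ^ 2 : ℝ) : EReal) ≤ ((r * P.etaReal x' y : ℝ) : EReal) :=
        (le_add_of_nonneg_left (hP.zeta_nonneg x' hx')).trans h
      have h2 := hpos.trans_le (EReal.coe_le_coe_iff.1 h1)
      exact pos_of_mul_pos_right h2 hr
  have hadm : P.Admissible x' y := ⟨hx', hxy.mem_dom_conj, hη⟩
  refine ⟨hadm, ?_⟩
  rw [hP.zeta_eq_coe hx' hadm.mem_Omega, ← EReal.coe_add, EReal.coe_le_coe_iff] at h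
  exact h

/-- Sufficiently small trial step sizes pass the line-search test, uniformly as long as `x` stays
in a compact set, `Q(x, y)` stays bounded and `η(x, y)` stays away from zero. -/
theorem exists_stepsize (c : MPGAParams) {X : Set (Rn n)} (hX : IsCompact X)
    (hXf : X ⊆ effDom P.f) (hXΩ : X ⊆ P.Omega) (K : ℝ) {η₀ : ℝ} (hη₀ : 0 < η₀) :
    ∃ a > 0, ∀ x ∈ X, ∀ y, P.Admissible x y → η₀ ≤ P.etaReal x y →
      P.zetaReal x / P.etaReal x y ≤ K → ∀ r : ℝ, P.zetaReal x / P.etaReal x y ≤ r →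
      ∀ (i : Fin N), ∀ α > 0, α ≤ a → ∀ z ∈ P.trialSet i α x y,
        P.LineSearchTest c r i x y z := by
  obtain ⟨L, hL0, δ, hδ, hdesc⟩ := hP.exists_uniform_descent hX hXΩ
  obtain ⟨B, hB0, hB⟩ := hP.exists_norm_bound hX
  obtain ⟨C, hC0, hC⟩ := hP.exists_block_bound hX hXf
  obtain ⟨V, hV0, hV⟩ := hP.exists_direction_bound hX hXΩ K
  have hσ := c.σ_pos
  -- Below, the trial point stays at distance at most `ρ`, at which `h` obeys the quadratic bound
  -- and `η` is still nonnegative.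
  set ρ := min δ (η₀ / (B + 1)) with hρ
  have hρ0 : 0 < ρ := lt_min hδ (by positivity)
  have hρB : ρ * B ≤ η₀ := by
    have h1 : ρ ≤ η₀ / (B + 1) := min_le_right _ _
    rw [le_div_iff₀ (by positivity)] at h1
    nlinarith
  set W := C / ρ + V with hW
  have hW0 : 0 ≤ W := by positivity
  refine ⟨min (ρ / (2 * (W + 1))) (1 / (2 * (L + c.σ))), lt_min (by positivity) (by positivity),
    fun x hx y hxy hη hK r hr i α hα hαa z hz => ?_⟩
  have hα1 : α * (2 * (W + 1)) ≤ ρ := by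
    rw [← le_div_iff₀ (by positivity)]; exact hαa.trans (min_le_left _ _)
  have hα2 : L + c.σ ≤ (2 * α)⁻¹ := by
    have h1 := hαa.trans (min_le_right _ _)
    rw [le_div_iff₀ (by positivity)] at h1
    rw [le_inv_comm₀ (by positivity) (by positivity), ← one_div, le_div_iff₀ (by positivity)]
    linarith
  obtain ⟨hzd, hmin⟩ := hP.trialSet_optimal hα hxy hz
  have hxi := hP.mem_effDom_f_iff.1 hxy.mem_dom_f i
  have h0 := hmin _ hxi
  rw [sub_self, norm_zero, inner_zero_right] at h0
  set x' := replaceBlock P.blk i x z with hx'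
  have hd : ‖x' - x‖ = ‖z - subvec P.blk i x‖ := norm_replaceBlock_sub i x z
  have hin : ⟪P.direction x y, x' - x⟫_ℝ
      = ⟪subvec P.blk i (P.direction x y), z - subvec P.blk i x⟫_ℝ := inner_replaceBlock_sub i _ x z
  rw [← hd, ← hin] at h0
  have hf := P.fReal_replaceBlock i x z
  rw [← hx'] at hf
  have hlow : -(V * ‖x' - x‖) ≤ ⟪P.direction x y, x' - x⟫_ℝ := by
    have h1 := abs_real_inner_le_norm (P.direction x y) (x' - x)
    have h2 := mul_le_mul_of_nonneg_right (hV x hx y hxy hK) (norm_nonneg (x' - x))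
    linarith [neg_abs_le ⟪P.direction x y, x' - x⟫_ℝ]
  have hdρ : ‖x' - x‖ ≤ ρ := by
    by_contra hcon
    have hgt := not_le.1 hcon
    have h1 := hC x hx i z hzd
    have h2 : C ≤ C / ρ * ‖x' - x‖ := by
      rw [div_mul_eq_mul_div, le_div_iff₀ hρ0]
      exact mul_le_mul_of_nonneg_left hgt.le hC0
    have h3 : (2 * α)⁻¹ * ‖x' - x‖ ^ 2 ≤ W * ‖x' - x‖ := by
      rw [hW]; linarith
    have h4 : ‖x' - x‖ ^ 2 ≤ 2 * α * (W * ‖x' - x‖) := by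
      rwa [inv_mul_le_iff₀ (by positivity)] at h3
    have h5 : ‖x' - x‖ ≤ 2 * α * W := by
      refine le_of_mul_le_mul_right ?_ (hρ0.trans hgt)
      linarith
    linarith
  obtain ⟨hΩ, hh⟩ := hdesc x hx x' (hdρ.trans (min_le_left _ _))
  have hη' : 0 ≤ P.etaReal x' y := by
    have h1 := P.etaReal_sub x x' y
    have h2 := abs_real_inner_le_norm (x' - x) y
    have h3 : ‖x' - x‖ * ‖y‖ ≤ ρ * B :=
      mul_le_mul hdρ (hB x hx y hxy.mem_dom_conj hxy.eta_pos) (norm_nonneg _) hρ0.le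
    linarith [neg_abs_le ⟪x' - x, y⟫_ℝ]
  have hxd := hP.replaceBlock_mem_dom hxy.mem_dom_f hzd
  rw [LineSearchTest, ← hx', hP.zeta_eq_coe hxd hΩ, P.eta_eq_coe hxy.mem_dom_conj,
    ← EReal.coe_add, ← EReal.coe_mul, EReal.coe_le_coe_iff]
  have hdir : ⟪P.direction x y, x' - x⟫_ℝ = ⟪P.gradh x, x' - x⟫_ℝ
      - P.zetaReal x / P.etaReal x y * (P.etaReal x' y - P.etaReal x y) := by
    rw [direction, inner_sub_left, inner_smul_left, P.etaReal_sub, real_inner_comm (x' - x) y]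
    simp
  have hζ : P.zetaReal x = P.zetaReal x / P.etaReal x y * P.etaReal x y :=
    (div_mul_cancel₀ _ hxy.eta_pos.ne').symm
  have hζ' : P.zetaReal x' - P.zetaReal x
      = (P.fReal x' - P.fReal x) + ((P.h x').toReal - (P.h x).toReal) := by
    simp only [zetaReal]; ring
  have hr' := mul_le_mul_of_nonneg_right hr hη'
  have hsq := mul_le_mul_of_nonneg_right hα2 (sq_nonneg ‖x' - x‖)
  have hσsq : 0 ≤ c.σ * ‖x' - x‖ ^ 2 := by positivity
  linarith

/-- With `η(x, y)` bounded away from zero, accepted `x`-steps satisfy the optimality inequality of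
the proximal model with a uniform constant. -/
theorem exists_accepted_optimal (c : MPGAParams) {X : Set (Rn n)} (hX : IsCompact X)
    (hXf : X ⊆ effDom P.f) (hXΩ : X ⊆ P.Omega) (K : ℝ) {η₀ : ℝ} (hη₀ : 0 < η₀) :
    ∃ b : ℝ, ∀ x ∈ X, ∀ y, P.Admissible x y → η₀ ≤ P.etaReal x y →
      P.zetaReal x / P.etaReal x y ≤ K → ∀ r : ℝ, P.zetaReal x / P.etaReal x y ≤ r →
      ∀ (i : Fin N) (x' y' : Rn n), P.StepX c r i x y x' y' → ∀ w ∈ effDom (P.fi i),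
        P.fReal x' - P.fReal x + (P.fi i (subvec P.blk i x)).toReal
            + ⟪P.direction x y, x' - x⟫_ℝ
          ≤ (P.fi i w).toReal + b * ‖w - subvec P.blk i x‖ ^ 2
            + ⟪subvec P.blk i (P.direction x y), w - subvec P.blk i x⟫_ℝ := by
  obtain ⟨a, ha, htest⟩ := hP.exists_stepsize c hX hXf hXΩ K hη₀
  have hγ := c.γ_pos
  have hlo := c.αlo_pos
  -- The accepted step size is either the initial one or the successor of a rejected one.
  set α₀ := min c.αlo (a * c.γ) with hα₀
  have hα₀pos : 0 < α₀ := lt_min hlo (mul_pos ha hγ)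
  refine ⟨(2 * α₀)⁻¹, fun x hx y hxy hη hK r hr i x' y' hstep w hw => ?_⟩
  obtain ⟨-, α, hα, k, z, htrial, hrej, -, rfl⟩ := hstep
  have hαpos : 0 < α := hlo.trans_le hα.1
  have hge : α₀ ≤ α * c.γ ^ k := by
    rcases Nat.eq_zero_or_pos k with rfl | hk
    · rw [pow_zero, mul_one]; exact (min_le_left _ _).trans hα.1
    · obtain ⟨j, rfl⟩ := Nat.exists_eq_succ_of_ne_zero hk.ne'
      have hgt : a < α * c.γ ^ j := by
        by_contra hcon
        exact hrej j (Nat.lt_succ_self j) (htest x hx y hxy hη hK r hr i _ (by positivity)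
          (not_lt.1 hcon) _ (htrial j (Nat.le_succ j)))
      rw [Nat.succ_eq_add_one, pow_succ, ← mul_assoc]
      exact (min_le_right _ _).trans (mul_le_mul_of_nonneg_right hgt.le hγ.le)
  obtain ⟨-, hmin⟩ := hP.trialSet_optimal (by positivity) hxy (htrial k le_rfl)
  have h := hmin w hw
  have hinv : (2 * (α * c.γ ^ k))⁻¹ ≤ (2 * α₀)⁻¹ := by gcongr
  have h1 := mul_le_mul_of_nonneg_right hinv (sq_nonneg ‖w - subvec P.blk i x‖)
  have h2 : 0 ≤ (2 * (α * c.γ ^ k))⁻¹ * ‖z k - subvec P.blk i x‖ ^ 2 := by positivity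
  rw [P.fReal_replaceBlock, inner_replaceBlock_sub]
  linarith

end Standing

end FracProblem

/-! ### Runs of the algorithm in real-valued form -/

namespace FracProblem

variable {n N : ℕ} (P : FracProblem n N)

/-- A run of the algorithm, described by real numbers: all iterates are admissible, `R t` is the
reference value of the line search at time `t`, and both kinds of steps satisfy the sufficient
decrease inequality with respect to it. -/
structure RealRun (c : MPGAParams) (K : ℝ) (idx : ℕ → Fin (N + 1)) (x y : ℕ → Rn n)
    (R : ℕ → ℝ) : Prop where
  admissible : ∀ t, P.Admissible (x t) (y t)
  ratio_le : ∀ t, P.zetaReal (x t) / P.etaReal (x t) (y t) ≤ R t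
  R_le : ∀ t, R t ≤ K
  R_antitone : Antitone R
  exists_eq : ∀ t, ∃ j ≤ c.M, R (t + c.M) =
    P.zetaReal (x (t + j)) / P.etaReal (x (t + j)) (y (t + j))
  descent : ∀ t, P.zetaReal (x (t + 1)) + c.σ / 2 * ‖x (t + 1) - x t‖ ^ 2
    ≤ R t * P.etaReal (x (t + 1)) (y (t + 1))
  step_y : ∀ t, idx t = 0 → x (t + 1) = x t ∧ ∃ α ∈ Set.Icc c.αlo c.αhi,
    y (t + 1) ∈ convexSubdiff P.g (x t + α⁻¹ • (y t - y (t + 1)))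
  step_x : ∀ t (i : Fin N), idx t = i.succ →
    y (t + 1) = y t ∧ P.StepX c (R t) i (x t) (y t) (x (t + 1)) (y (t + 1))

/-- As long as the iterates are admissible, the reference value is the real maximum of the quotients
`ζ / η` over the window. -/
theorem refValue_spec {P : FracProblem n N} (hP : P.Standing) (c : MPGAParams) {x y : ℕ → Rn n}
    {t : ℕ} (h : ∀ s ≤ t, P.Admissible (x s) (y s)) :
    P.refValue c x y t = ((P.refValue c x y t).toReal : EReal) ∧
    (∀ s ∈ Finset.Icc (t - c.M) t,
      P.zetaReal (x s) / P.etaReal (x s) (y s) ≤ (P.refValue c x y t).toReal) ∧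
    ∃ s ∈ Finset.Icc (t - c.M) t,
      (P.refValue c x y t).toReal = P.zetaReal (x s) / P.etaReal (x s) (y s) := by
  have hQ : ∀ s ∈ Finset.Icc (t - c.M) t,
      P.Q (x s) (y s) = ((P.zetaReal (x s) / P.etaReal (x s) (y s) : ℝ) : EReal) := fun s hs =>
    have ha := h s (Finset.mem_Icc.1 hs).2
    hP.Q_eq_coe ha.mem_dom_f ha.mem_dom_conj ha.eta_pos
  obtain ⟨s, hs, heq⟩ := Finset.exists_mem_eq_sup (Finset.Icc (t - c.M) t)
    ⟨t, Finset.mem_Icc.2 ⟨Nat.sub_le _ _, le_rfl⟩⟩ (fun s => P.Q (x s) (y s))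
  have heq' : P.refValue c x y t = ((P.zetaReal (x s) / P.etaReal (x s) (y s) : ℝ) : EReal) := by
    rw [refValue, heq, hQ s hs]
  have hreal : (P.refValue c x y t).toReal = P.zetaReal (x s) / P.etaReal (x s) (y s) := by
    rw [heq', EReal.toReal_coe]
  refine ⟨by rw [hreal, heq'], fun r hr => ?_, s, hs, hreal⟩
  have hle : P.Q (x r) (y r) ≤ P.refValue c x y t :=
    Finset.le_sup (f := fun s => P.Q (x s) (y s)) hr
  rw [heq', hQ r hr, EReal.coe_le_coe_iff] at hle
  rw [hreal]
  exact hle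

namespace Standing

variable {P} (hP : P.Standing)
include hP

theorem ratio_nonneg {x y : Rn n} (h : P.Admissible x y) :
    0 ≤ P.zetaReal x / P.etaReal x y :=
  div_nonneg (hP.zetaReal_nonneg h.mem_dom_f h.mem_Omega) h.eta_pos.le

theorem stepY_real {c : MPGAParams} {x y x' y' : Rn n} (hxy : P.Admissible x y)
    (h : P.StepY c x y x' y') : x' = x ∧ P.Admissible x' y' ∧
      P.etaReal x y ≤ P.etaReal x' y' ∧ ∃ α ∈ Set.Icc c.αlo c.αhi,
        y' ∈ convexSubdiff P.g (x + α⁻¹ • (y - y')) := by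
  obtain ⟨rfl, α, hα, hprox⟩ := h
  have hαpos : 0 < α := c.αlo_pos.trans_le hα.1
  have hsub := mem_convexSubdiff_of_mem_prox_conjugate hP.g_convex hP.continuous_g hαpos hprox
  have hinc := inner_sub_conjugate_add_le hxy.mem_dom_conj hsub
  have hsq : 0 ≤ α⁻¹ * ‖y' - y‖ ^ 2 := by positivity
  have hle : P.etaReal x' y ≤ P.etaReal x' y' := by
    simp only [etaReal]; linarith
  exact ⟨rfl, ⟨hxy.mem_dom_f, mem_effDom_conjugate_of_mem_convexSubdiff hsub,
    hxy.eta_pos.trans_le hle⟩, hle, α, hα, hsub⟩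

theorem stepX_real {c : MPGAParams} {r : ℝ} (hr : 0 ≤ r) {i : Fin N} {x y x' y' : Rn n}
    (hxy : P.Admissible x y) (h : P.StepX c r i x y x' y') :
    y' = y ∧ P.Admissible x' y' ∧
      P.zetaReal x' + c.σ / 2 * ‖x' - x‖ ^ 2 ≤ r * P.etaReal x' y' := by
  obtain ⟨rfl, α, hα, k, z, htrial, -, hacc, rfl⟩ := h
  have hαpos : 0 < α := c.αlo_pos.trans_le hα.1
  have hγ := c.γ_pos
  obtain ⟨hzd, -⟩ := hP.trialSet_optimal (by positivity) hxy (htrial k le_rfl)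
  exact ⟨rfl, hP.lineSearchTest_real hr hxy hzd hacc⟩

/-- One step from a history of admissible pairs. -/
theorem step_real {c : MPGAParams} {x₀ y₀ : Rn n} {idx : ℕ → Fin (N + 1)} {x y : ℕ → Rn n}
    (hrun : P.IsMPGARun c x₀ y₀ idx x y) {t : ℕ} (h : ∀ s ≤ t, P.Admissible (x s) (y s)) :
    P.Admissible (x (t + 1)) (y (t + 1)) ∧
      P.zetaReal (x (t + 1)) + c.σ / 2 * ‖x (t + 1) - x t‖ ^ 2
        ≤ (P.refValue c x y t).toReal * P.etaReal (x (t + 1)) (y (t + 1)) := by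
  obtain ⟨hcoe, hle, -⟩ := refValue_spec hP c h
  have hq := hle t (Finset.mem_Icc.2 ⟨Nat.sub_le _ _, le_rfl⟩)
  have hr : 0 ≤ (P.refValue c x y t).toReal := (hP.ratio_nonneg (h t le_rfl)).trans hq
  rcases Fin.eq_zero_or_eq_succ (idx t) with h0 | ⟨i, hi⟩
  · obtain ⟨hx, hadm, hη, -⟩ := hP.stepY_real (h t le_rfl) (hrun.step_y t h0)
    refine ⟨hadm, ?_⟩
    rw [div_le_iff₀ (h t le_rfl).eta_pos] at hq
    have hη' := mul_le_mul_of_nonneg_left hη hr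
    rw [hx] at hη' ⊢
    simp only [sub_self, norm_zero]
    linarith
  · have hs := hrun.step_x t i hi
    rw [hcoe] at hs
    exact (hP.stepX_real hr (h t le_rfl) hs).2

/-- Every run from `x₀ ∈ dom F` and `y₀ ∈ ∂g(x₀)` has a real-valued form. The choice of `y₀` makes
`Q(x₀, y₀) = F(x₀)`, which bounds all reference values. -/
theorem exists_realRun {c : MPGAParams} {x₀ y₀ : Rn n} (hx₀ : x₀ ∈ effDom P.F)
    (hy₀ : y₀ ∈ convexSubdiff P.g x₀) {idx : ℕ → Fin (N + 1)} {x y : ℕ → Rn n}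
    (hrun : P.IsMPGARun c x₀ y₀ idx x y) :
    ∃ R, P.RealRun c (P.zetaReal x₀ / P.g x₀) idx x y R := by
  obtain ⟨hΩ₀, hf₀⟩ := hP.mem_effDom_F_iff.1 hx₀
  have hη₀ : P.etaReal x₀ y₀ = P.g x₀ := by
    rw [etaReal, toReal_conjugate_of_mem_convexSubdiff hy₀]; ring
  have hall : ∀ t, ∀ s ≤ t, P.Admissible (x s) (y s) := by
    intro t
    induction t with
    | zero =>
      intro s hs
      obtain rfl := Nat.le_zero.1 hs
      rw [hrun.init_x, hrun.init_y]
      exact ⟨hf₀, mem_effDom_conjugate_of_mem_convexSubdiff hy₀, hη₀ ▸ hP.g_pos hΩ₀⟩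
    | succ t ih =>
      intro s hs
      rcases Nat.le_succ_iff.1 hs with h | rfl
      · exact ih s h
      · exact (hP.step_real hrun ih).1
  have hadm : ∀ t, P.Admissible (x t) (y t) := fun t => hall t t le_rfl
  have hspec := fun t => refValue_spec hP c (hall t)
  have hself : ∀ t, t ∈ Finset.Icc (t - c.M) t := fun t =>
    Finset.mem_Icc.2 ⟨Nat.sub_le _ _, le_rfl⟩
  have hdesc := fun t => (hP.step_real hrun (hall t)).2
  have hanti : Antitone fun t => (P.refValue c x y t).toReal := by
    refine antitone_nat_of_succ_le fun t => ?_
    obtain ⟨s, hs, heq⟩ := (hspec (t + 1)).2.2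
    rw [heq]
    rw [Finset.mem_Icc] at hs
    rcases Nat.le_succ_iff.1 hs.2 with h | rfl
    · exact (hspec t).2.1 s (Finset.mem_Icc.2 ⟨by omega, h⟩)
    · rw [div_le_iff₀ (hadm _).eta_pos]
      have hsq : 0 ≤ c.σ / 2 * ‖x (t + 1) - x t‖ ^ 2 := by
        have := c.σ_pos
        positivity
      linarith [hdesc t]
  refine ⟨fun t => (P.refValue c x y t).toReal, hadm, fun t => (hspec t).2.1 t (hself t),
    fun t => (hanti (Nat.zero_le t)).trans ?_, hanti, fun t => ?_, hdesc, fun t ht => ?_,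
    fun t i hi => ?_⟩
  · obtain ⟨s, hs, heq⟩ := (hspec 0).2.2
    obtain rfl : s = 0 := Nat.le_zero.1 (Finset.mem_Icc.1 hs).2
    simp only [heq, hrun.init_x, hrun.init_y, hη₀, le_refl]
  · obtain ⟨s, hs, heq⟩ := (hspec (t + c.M)).2.2
    rw [Finset.mem_Icc, Nat.add_sub_cancel] at hs
    refine ⟨s - t, by omega, ?_⟩
    rw [Nat.add_sub_cancel' hs.1]
    exact heq
  · obtain ⟨hx, -, -, hα⟩ := hP.stepY_real (hadm t) (hrun.step_y t ht)
    exact ⟨hx, hα⟩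
  · have hs := hrun.step_x t i hi
    rw [(hspec t).1] at hs
    exact ⟨hs.1, hs⟩

end Standing

namespace RealRun

variable {P} {c : MPGAParams} {K : ℝ} {idx : ℕ → Fin (N + 1)} {x y : ℕ → Rn n} {R : ℕ → ℝ}

theorem ratio_le_const (h : P.RealRun c K idx x y R) (t : ℕ) :
    P.zetaReal (x t) / P.etaReal (x t) (y t) ≤ K :=
  (h.ratio_le t).trans (h.R_le t)

theorem R_nonneg (hP : P.Standing) (h : P.RealRun c K idx x y R) (t : ℕ) : 0 ≤ R t :=
  (hP.ratio_nonneg (h.admissible t)).trans (h.ratio_le t)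

theorem F_le (hP : P.Standing) (h : P.RealRun c K idx x y R) (t : ℕ) : P.F (x t) ≤ (K : EReal) := by
  have ha := h.admissible t
  rw [hP.F_eq_coe ha.mem_dom_f ha.mem_Omega, EReal.coe_le_coe_iff]
  refine le_trans ?_ (h.ratio_le_const t)
  exact div_le_div_of_nonneg_left (hP.zetaReal_nonneg ha.mem_dom_f ha.mem_Omega) ha.eta_pos
    (P.etaReal_le_g ha.mem_dom_conj _)

/-! ### Asymptotics of a run -/

/-- The reference values converge to a limit `q ≥ 0`, and `ζ(x) - q η(x, y) → 0` and
`x (t + 1) - x t → 0` along the whole run. Working with `ζ - q η` instead of the quotient `Q` avoids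
a lower bound on `η`, which is not available if `ζ` is not bounded away from zero. -/
theorem exists_limit (hP : P.Standing) (h : P.RealRun c K idx x y R) {X : Set (Rn n)}
    (hX : IsCompact X) (hXf : X ⊆ effDom P.f) (hXΩ : X ⊆ P.Omega) (hx : ∀ t, x t ∈ X) :
    ∃ q ≥ 0,
      Tendsto (fun t => P.zetaReal (x t) - q * P.etaReal (x t) (y t)) atTop (𝓝 0) ∧
      Tendsto (fun t => ‖x (t + 1) - x t‖) atTop (𝓝 0) := by
  have hbdd : BddBelow (Set.range R) := ⟨0, by rintro _ ⟨t, rfl⟩; exact h.R_nonneg hP t⟩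
  have hRlim := tendsto_atTop_ciInf h.R_antitone hbdd
  set q := ⨅ t, R t with hq
  have hqR : ∀ t, q ≤ R t := fun t => ciInf_le hbdd t
  have hq0 : 0 ≤ q := le_ciInf fun t => h.R_nonneg hP t
  obtain ⟨G, hG⟩ := hX.bddAbove_image hP.continuous_g.continuousOn
  obtain ⟨B, hB0, hB⟩ := hP.exists_norm_bound hX
  have hσ := c.σ_pos
  set ψ : ℕ → ℝ := fun t => P.zetaReal (x t) - q * P.etaReal (x t) (y t) with hψ
  have hηG : ∀ t, P.etaReal (x t) (y t) ≤ G := fun t =>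
    (P.etaReal_le_g (h.admissible t).mem_dom_conj _).trans (hG ⟨x t, hx t, rfl⟩)
  have hdesc : ∀ t, ψ (t + 1) + c.σ / 2 * ‖x (t + 1) - x t‖ ^ 2 ≤ (R t - q) * G := by
    intro t
    have h1 := h.descent t
    have h2 := mul_le_mul_of_nonneg_left (hηG (t + 1)) (sub_nonneg.2 (hqR t))
    simp only [hψ]
    linarith
  have herr : Tendsto (fun t => (R t - q) * G) atTop (𝓝 0) := by
    simpa using (hRlim.sub_const q).mul_const G
  have hup : ∀ ε > 0, ∀ᶠ t in atTop, ψ t ≤ ε := by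
    intro ε hε
    obtain ⟨T, hT⟩ := eventually_atTop.1 (herr.eventually (gt_mem_nhds hε))
    refine eventually_atTop.2 ⟨T + 1, fun t ht => ?_⟩
    obtain ⟨s, rfl⟩ : ∃ s, t = s + 1 := ⟨t - 1, by omega⟩
    have h1 := hT s (by omega)
    have hsq : 0 ≤ c.σ / 2 * ‖x (s + 1) - x s‖ ^ 2 := by positivity
    linarith [hdesc s]
  have hwin : ∀ t, ∃ j ≤ c.M, 0 ≤ ψ (t + j) := by
    intro t
    obtain ⟨j, hj, heq⟩ := h.exists_eq t
    refine ⟨j, hj, ?_⟩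
    have h1 := hqR (t + c.M)
    rw [heq, le_div_iff₀ (h.admissible _).eta_pos] at h1
    simpa [hψ] using h1
  have hζ := hX.uniformContinuousOn_of_continuous
    (hP.continuousOn_zetaReal.mono fun u hu => ⟨hXf hu, hXΩ hu⟩)
  rw [Metric.uniformContinuousOn_iff] at hζ
  have hstep : ∀ ε > 0, ∃ ρ > 0, ∀ t, ‖x (t + 1) - x t‖ < ρ → ψ (t + 1) - ε ≤ ψ t := by
    intro ε hε
    obtain ⟨ρ, hρ, hρζ⟩ := hζ (ε / 2) (half_pos hε)
    refine ⟨min ρ (ε / (2 * (q * B + 1))), lt_min hρ (by positivity), fun t ht => ?_⟩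
    have h1 := hρζ _ (hx (t + 1)) _ (hx t) (by
      rw [dist_eq_norm]; exact ht.trans_le (min_le_left _ _))
    rw [Real.dist_eq] at h1
    have h1' := (abs_lt.1 h1).2
    rcases Fin.eq_zero_or_eq_succ (idx t) with h0 | ⟨i, hi⟩
    · obtain ⟨hxe, α, hα, hsub⟩ := h.step_y t h0
      have hinc := inner_sub_conjugate_add_le (h.admissible t).mem_dom_conj hsub
      have hαpos : 0 < α := c.αlo_pos.trans_le hα.1
      have hsq : 0 ≤ α⁻¹ * ‖y (t + 1) - y t‖ ^ 2 := by positivity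
      have hle : P.etaReal (x t) (y t) ≤ P.etaReal (x t) (y (t + 1)) := by
        simp only [etaReal]; linarith
      have := mul_le_mul_of_nonneg_left hle hq0
      simp only [hψ, hxe]
      linarith
    · obtain ⟨hye, -⟩ := h.step_x t i hi
      have h2 := P.etaReal_sub (x t) (x (t + 1)) (y t)
      have h3 := abs_real_inner_le_norm (x (t + 1) - x t) (y t)
      have h4 : ‖x (t + 1) - x t‖ * ‖y t‖ ≤ ‖x (t + 1) - x t‖ * B :=
        mul_le_mul_of_nonneg_left (hB _ (hx t) _ (h.admissible t).mem_dom_conj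
          (h.admissible t).eta_pos) (norm_nonneg _)
      have h5 : ‖x (t + 1) - x t‖ * (2 * (q * B + 1)) < ε := by
        rw [← lt_div_iff₀ (by positivity)]; exact ht.trans_le (min_le_right _ _)
      have h6 : -(‖x (t + 1) - x t‖ * B) ≤ P.etaReal (x (t + 1)) (y t) - P.etaReal (x t) (y t) := by
        rw [h2]; linarith [neg_abs_le ⟪x (t + 1) - x t, y t⟫_ℝ]
      have h7 := mul_le_mul_of_nonneg_left h6 hq0
      have h8 := norm_nonneg (x (t + 1) - x t)
      simp only [hψ, hye]
      linarith
  have hback : ∀ ε > 0, ∃ δ > 0, ∀ᶠ t in atTop, -δ ≤ ψ (t + 1) → -ε ≤ ψ t := by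
    intro ε hε
    obtain ⟨ρ, hρ, hρψ⟩ := hstep (ε / 2) (half_pos hε)
    refine ⟨min (ε / 2) (c.σ / 4 * ρ ^ 2), lt_min (half_pos hε) (by positivity), ?_⟩
    filter_upwards [herr.eventually (gt_mem_nhds (show 0 < c.σ / 4 * ρ ^ 2 by positivity))]
      with t ht hδ
    have h1 := hdesc t
    have h2 := min_le_left (ε / 2) (c.σ / 4 * ρ ^ 2)
    have h3 := min_le_right (ε / 2) (c.σ / 4 * ρ ^ 2)
    have h4 : ‖x (t + 1) - x t‖ < ρ := by
      refine lt_of_pow_lt_pow_left₀ 2 hρ.le ?_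
      refine lt_of_mul_lt_mul_left ?_ (half_pos hσ).le
      linarith
    linarith [hρψ t h4]
  have hψ0 := tendsto_zero_of_window_nonneg c.M hup hwin hback
  refine ⟨q, hq0, hψ0, ?_⟩
  have hlim : Tendsto (fun t => √(2 / c.σ * ((R t - q) * G - ψ (t + 1)))) atTop (𝓝 0) := by
    have h1 := ((herr.sub ((tendsto_add_atTop_iff_nat 1).2 hψ0)).const_mul (2 / c.σ)).sqrt
    simpa using h1
  refine squeeze_zero (fun t => norm_nonneg _) (fun t => ?_) hlim
  refine Real.le_sqrt_of_sq_le ?_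
  rw [div_mul_eq_mul_div, le_div_iff₀ hσ]
  linarith [hdesc t]

/-- At the times of `y`-updates, the product of `ζ` with the gap in the Fenchel–Young inequality is
asymptotically zero. The factor `ζ` accounts for the case in which the reference values tend to
zero, where nothing is claimed about `y`. -/
theorem eventually_gap_le (hP : P.Standing) (h : P.RealRun c K idx x y R) {X : Set (Rn n)}
    (hX : IsCompact X) (hXf : X ⊆ effDom P.f) (hXΩ : X ⊆ P.Omega) (hx : ∀ t, x t ∈ X)
    {ε : ℝ} (hε : 0 < ε) :
    ∀ᶠ t in atTop, idx t = 0 →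
      P.zetaReal (x t) * (P.g (x t) - P.etaReal (x t) (y t)) ≤ ε := by
  obtain ⟨q, hq0, hψ0, -⟩ := h.exists_limit hP hX hXf hXΩ hx
  obtain ⟨G, hG⟩ := hX.bddAbove_image hP.continuous_g.continuousOn
  have hgG : ∀ t, P.g (x t) ≤ G := fun t => hG ⟨x t, hx t, rfl⟩
  obtain ⟨B, hB0, hB⟩ := hP.exists_norm_bound hX
  have hζ0 : ∀ t, 0 ≤ P.zetaReal (x t) := fun t =>
    hP.zetaReal_nonneg (h.admissible t).mem_dom_f (h.admissible t).mem_Omega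
  rcases hq0.eq_or_lt with rfl | hqpos
  · have hlim : Tendsto (fun t => P.zetaReal (x t) * G) atTop (𝓝 0) := by
      simpa using hψ0.mul_const G
    filter_upwards [hlim.eventually (gt_mem_nhds hε)] with t ht _
    have h1 := (h.admissible t).eta_pos
    have h2 := mul_le_mul_of_nonneg_left (hgG t) (hζ0 t)
    have h3 := mul_nonneg (hζ0 t) h1.le
    linarith
  · have hhi : 0 < c.αhi := c.αlo_pos.trans_le c.αlo_le_αhi
    -- `d t` is the increase of `η` in a `y`-update.
    set d : ℕ → ℝ := fun t => (P.zetaReal (x t) - q * P.etaReal (x t) (y t)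
      - (P.zetaReal (x (t + 1)) - q * P.etaReal (x (t + 1)) (y (t + 1)))) / q with hd
    have hd0 : Tendsto d atTop (𝓝 0) := by
      simpa using (hψ0.sub ((tendsto_add_atTop_iff_nat 1).2 hψ0)).div_const q
    have hlim : Tendsto (fun t => K * G * (d t + 2 * B / c.αlo * √(c.αhi * d t))) atTop (𝓝 0) := by
      have h1 := (hd0.add (((hd0.const_mul c.αhi).sqrt).const_mul
        (2 * B / c.αlo))).const_mul (K * G)
      simpa using h1
    filter_upwards [hlim.eventually (gt_mem_nhds hε)] with t ht h0
    refine le_trans ?_ ht.le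
    obtain ⟨hxe, α, hα, hsub⟩ := h.step_y t h0
    have hαpos : 0 < α := c.αlo_pos.trans_le hα.1
    have hdt : d t = P.etaReal (x t) (y (t + 1)) - P.etaReal (x t) (y t) := by
      simp only [hd, hxe]
      field_simp
      ring
    have hinc := inner_sub_conjugate_add_le (h.admissible t).mem_dom_conj hsub
    have hinc' : α⁻¹ * ‖y (t + 1) - y t‖ ^ 2 ≤ d t := by
      rw [hdt]; simp only [etaReal]; linarith
    have hd_nonneg : 0 ≤ d t := le_trans (by positivity) hinc'
    have hΔ : ‖y (t + 1) - y t‖ ≤ √(c.αhi * d t) := by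
      refine Real.le_sqrt_of_sq_le ?_
      rw [inv_mul_le_iff₀ hαpos] at hinc'
      exact hinc'.trans (mul_le_mul_of_nonneg_right hα.2 hd_nonneg)
    obtain ⟨s, hs⟩ := convexSubdiff_nonempty hP.g_convex hP.continuous_g (x t)
    have hsB : ‖s‖ ≤ B := by
      refine hB _ (hx t) s (mem_effDom_conjugate_of_mem_convexSubdiff hs) ?_
      rw [etaReal, toReal_conjugate_of_mem_convexSubdiff hs, sub_sub_cancel]
      exact hP.g_pos (h.admissible t).mem_Omega
    have hyB : ‖y (t + 1)‖ ≤ B := by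
      have ha := h.admissible (t + 1)
      exact hB _ (hx (t + 1)) _ ha.mem_dom_conj ha.eta_pos
    have hgap : P.g (x t) - P.etaReal (x t) (y (t + 1))
        ≤ 2 * B / c.αlo * √(c.αhi * d t) := by
      have h1 := hs (x t + α⁻¹ • (y t - y (t + 1)))
      have h2 : P.etaReal (x t) (y (t + 1)) = P.g (x t + α⁻¹ • (y t - y (t + 1)))
          - ⟪y (t + 1), α⁻¹ • (y t - y (t + 1))⟫_ℝ := by
        rw [etaReal, toReal_conjugate_of_mem_convexSubdiff hsub, inner_add_left,
          real_inner_comm _ (y (t + 1))]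
        ring
      have h3 : ⟪y (t + 1) - s, α⁻¹ • (y t - y (t + 1))⟫_ℝ
          ≤ ‖y (t + 1) - s‖ * ‖α⁻¹ • (y t - y (t + 1))‖ := real_inner_le_norm _ _
      rw [inner_sub_left] at h3
      rw [add_sub_cancel_left] at h1
      have h4 : ‖y (t + 1) - s‖ ≤ 2 * B := (norm_sub_le _ _).trans (by linarith)
      have h5 : ‖α⁻¹ • (y t - y (t + 1))‖ ≤ c.αlo⁻¹ * √(c.αhi * d t) := by
        rw [norm_smul, Real.norm_of_nonneg (by positivity), norm_sub_rev]
        have := c.αlo_pos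
        exact mul_le_mul (inv_anti₀ this hα.1) hΔ (norm_nonneg _) (by positivity)
      have h6 := mul_le_mul h4 h5 (norm_nonneg _) (by positivity)
      rw [div_eq_mul_inv, mul_assoc]
      linarith
    have hζKG : P.zetaReal (x t) ≤ K * G := by
      have h1 := h.ratio_le_const t
      have ha := h.admissible t
      rw [div_le_iff₀ ha.eta_pos] at h1
      have hK0 : 0 ≤ K := (h.R_nonneg hP t).trans (h.R_le t)
      exact h1.trans (mul_le_mul_of_nonneg_left
        ((P.etaReal_le_g ha.mem_dom_conj _).trans (hgG t)) hK0)
    have hnn : 0 ≤ P.g (x t) - P.etaReal (x t) (y t) :=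
      sub_nonneg.2 (P.etaReal_le_g (h.admissible t).mem_dom_conj _)
    exact mul_le_mul hζKG (by linarith) hnn ((hζ0 t).trans hζKG)

/-- At the times of updates of the `i`-th block at which `η` is bounded away from zero, the current
point is asymptotically optimal for a proximal model of the objective in this block. The constant
depends neither on the run nor on the time. -/
theorem exists_eventually_block_optimal (hP : P.Standing) (c : MPGAParams) (K : ℝ)
    {X : Set (Rn n)} (hX : IsCompact X) (hXf : X ⊆ effDom P.f) (hXΩ : X ⊆ P.Omega)
    {η₀ : ℝ} (hη₀ : 0 < η₀) :
    ∃ b : ℝ, ∀ (idx : ℕ → Fin (N + 1)) (x y : ℕ → Rn n) (R : ℕ → ℝ), P.RealRun c K idx x y R →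
      (∀ t, x t ∈ X) → ∀ i : Fin N, ∀ ε > 0, ∀ᶠ t in atTop, idx t = i.succ →
        η₀ ≤ P.etaReal (x t) (y t) → ∀ w ∈ effDom (P.fi i),
          (P.fi i (subvec P.blk i (x t))).toReal
            ≤ (P.fi i w).toReal + b * ‖w - subvec P.blk i (x t)‖ ^ 2
              + ⟪subvec P.blk i (P.direction (x t) (y t)), w - subvec P.blk i (x t)⟫_ℝ + ε := by
  obtain ⟨b, hopt⟩ := hP.exists_accepted_optimal c hX hXf hXΩ K hη₀
  obtain ⟨V, hV0, hV⟩ := hP.exists_direction_bound hX hXΩ K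
  refine ⟨b, fun idx x y R h hx i ε hε => ?_⟩
  obtain ⟨-, -, -, hΔ⟩ := h.exists_limit hP hX hXf hXΩ hx
  have hf := hX.uniformContinuousOn_of_continuous (hP.continuousOn_fReal.mono hXf)
  rw [Metric.uniformContinuousOn_iff] at hf
  obtain ⟨ρ, hρ, hρf⟩ := hf (ε / 2) (half_pos hε)
  have hρ' : 0 < min ρ (ε / (2 * (V + 1))) := lt_min hρ (by positivity)
  filter_upwards [hΔ.eventually (gt_mem_nhds hρ')] with t ht hi hη w hw
  have ha := h.admissible t
  have h1 := hopt _ (hx t) _ ha hη (h.ratio_le_const t) _ (h.ratio_le t) i _ _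
    (h.step_x t i hi).2 w hw
  have h2 := hρf _ (hx (t + 1)) _ (hx t) (by
    rw [dist_eq_norm]; exact ht.trans_le (min_le_left _ _))
  rw [Real.dist_eq] at h2
  have h2' := (abs_lt.1 h2).1
  have h3 := abs_real_inner_le_norm (P.direction (x t) (y t)) (x (t + 1) - x t)
  have h4 := mul_le_mul_of_nonneg_right (hV _ (hx t) _ ha (h.ratio_le_const t))
    (norm_nonneg (x (t + 1) - x t))
  have h5 : ‖x (t + 1) - x t‖ * (2 * (V + 1)) < ε := by
    rw [← lt_div_iff₀ (by positivity)]; exact ht.trans_le (min_le_right _ _)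
  have h6 := norm_nonneg (x (t + 1) - x t)
  have h7 := neg_abs_le ⟪P.direction (x t) (y t), x (t + 1) - x t⟫_ℝ
  linarith

end RealRun

end FracProblem

/-! ### Accumulation points -/

namespace FracProblem

variable {n N : ℕ} {P : FracProblem n N}

/-- Points at which `ζ` attains its lower bound `0` are critical. -/
theorem Standing.isCritical_of_zetaReal_eq_zero (hP : P.Standing) {xs : Rn n}
    (hf : xs ∈ effDom P.f) (hΩ : xs ∈ P.Omega) (h0 : P.zetaReal xs = 0) (ys : Rn n) :
    P.IsCritical xs ∧ (P.F xs).toReal • ys ∈ (P.F xs).toReal • convexSubdiff P.g xs := by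
  have hF : (P.F xs).toReal = 0 := by
    rw [hP.F_eq_coe hf hΩ, h0, zero_div, EReal.toReal_coe]
  obtain ⟨s, hs⟩ := convexSubdiff_nonempty hP.g_convex hP.continuous_g xs
  refine ⟨⟨hP.mem_effDom_F_iff.2 ⟨hΩ, hf⟩, ?_⟩, ?_⟩
  · obtain ⟨L, -, δ, hδ, hdesc⟩ := hP.exists_uniform_descent (isCompact_singleton (x := xs))
      (Set.singleton_subset_iff.2 hΩ)
    have hsub : -P.gradh xs ∈ frechetSubdiff P.f xs := by
      refine mem_frechetSubdiff_of_quadratic hP.f_ne_bot hf (C := L) ?_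
      filter_upwards [Metric.closedBall_mem_nhds xs hδ] with w hw hwf
      rw [Metric.mem_closedBall, dist_eq_norm] at hw
      obtain ⟨hwΩ, hh⟩ := hdesc xs rfl w hw
      have hnn := hP.zetaReal_nonneg hwf hwΩ
      rw [hP.toReal_f hf, hP.toReal_f hwf, inner_neg_left]
      simp only [zetaReal] at hnn h0
      linarith
    rw [hF, Set.mem_sub]
    exact ⟨0, ⟨_, hsub, _, rfl, neg_add_cancel _⟩, 0, ⟨s, hs, zero_smul _ _⟩, sub_zero _⟩
  · rw [hF]
    exact ⟨s, hs, by simp⟩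

/-- The deterministic part of the convergence proof: if the Fenchel–Young gap and the residuals of
the block optimality conditions tend to zero along a run, its accumulation points are critical. -/
theorem RealRun.isCritical_of_mapClusterPt (hP : P.Standing) {c : MPGAParams} {K : ℝ}
    {idx : ℕ → Fin (N + 1)} {x y : ℕ → Rn n} {R : ℕ → ℝ} (h : P.RealRun c K idx x y R)
    {X : Set (Rn n)} (hX : IsCompact X) (hXf : X ⊆ effDom P.f) (hXΩ : X ⊆ P.Omega)
    (hx : ∀ t, x t ∈ X)
    (hgap : Tendsto (fun t => P.zetaReal (x t) * (P.g (x t) - P.etaReal (x t) (y t))) atTop (𝓝 0))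
    (hblock : ∀ η₀ > 0, ∃ b : ℝ, ∀ i : Fin N, ∀ ε > 0, ∀ᶠ t in atTop,
      η₀ ≤ P.etaReal (x t) (y t) → ∀ w ∈ effDom (P.fi i),
        (P.fi i (subvec P.blk i (x t))).toReal
          ≤ (P.fi i w).toReal + b * ‖w - subvec P.blk i (x t)‖ ^ 2
            + ⟪subvec P.blk i (P.direction (x t) (y t)), w - subvec P.blk i (x t)⟫_ℝ + ε)
    {xs ys : Rn n} (hcl : MapClusterPt (xs, ys) atTop fun t => (x t, y t)) :
    P.IsCritical xs ∧ (P.F xs).toReal • ys ∈ (P.F xs).toReal • convexSubdiff P.g xs := by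
  obtain ⟨φ, hφ, hlim⟩ := hcl.tendsto_subseq
  have hφ' := hφ.tendsto_atTop
  have hxlim : Tendsto (fun k => x (φ k)) atTop (𝓝 xs) := (continuous_fst.tendsto _).comp hlim
  have hylim : Tendsto (fun k => y (φ k)) atTop (𝓝 ys) := (continuous_snd.tendsto _).comp hlim
  have hxsX : xs ∈ X := hX.isClosed.mem_of_tendsto hxlim (Eventually.of_forall fun k => hx _)
  have hf := hXf hxsX
  have hΩ := hXΩ hxsX
  have hXlim : Tendsto (fun k => x (φ k)) atTop (𝓝[X] xs) :=
    tendsto_nhdsWithin_iff.2 ⟨hxlim, Eventually.of_forall fun k => hx _⟩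
  have hflim : Tendsto (fun k => P.fReal (x (φ k))) atTop (𝓝 (P.fReal xs)) :=
    (hP.continuousOn_fReal.mono hXf xs hxsX).tendsto.comp hXlim
  have hζlim : Tendsto (fun k => P.zetaReal (x (φ k))) atTop (𝓝 (P.zetaReal xs)) :=
    (hP.continuousOn_zetaReal.mono (fun u hu => ⟨hXf hu, hXΩ hu⟩) xs hxsX).tendsto.comp hXlim
  have hhlim : Tendsto (fun k => P.gradh (x (φ k))) atTop (𝓝 (P.gradh xs)) :=
    (hP.continuousOn_gradh.mono hXΩ xs hxsX).tendsto.comp hXlim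
  have hglim : Tendsto (fun k => P.g (x (φ k))) atTop (𝓝 (P.g xs)) :=
    (hP.continuous_g.tendsto xs).comp hxlim
  have hgpos := hP.g_pos hΩ
  rcases (hP.zetaReal_nonneg hf hΩ).eq_or_lt with h0 | hζpos
  · exact hP.isCritical_of_zetaReal_eq_zero hf hΩ h0.symm ys
  have hηlim : Tendsto (fun k => P.etaReal (x (φ k)) (y (φ k))) atTop (𝓝 (P.g xs)) := by
    have h1 := hglim.sub ((hgap.comp hφ').div hζlim hζpos.ne')
    rw [zero_div, sub_zero] at h1
    refine h1.congr' ?_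
    filter_upwards [hζlim.eventually (lt_mem_nhds hζpos)] with k hk
    simp only [Function.comp_apply, Pi.div_apply]
    field_simp
    ring
  have hsub : ys ∈ convexSubdiff P.g xs := by
    intro z
    have h1 : Tendsto (fun k => P.etaReal (x (φ k)) (y (φ k)) + ⟪y (φ k), z - x (φ k)⟫_ℝ) atTop
        (𝓝 (P.g xs + ⟪ys, z - xs⟫_ℝ)) := hηlim.add (hylim.inner (hxlim.const_sub z))
    refine le_of_tendsto h1 (Eventually.of_forall fun k => ?_)
    have h2 := P.etaReal_le_g (h.admissible (φ k)).mem_dom_conj z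
    have h3 := P.etaReal_sub (x (φ k)) z (y (φ k))
    rw [real_inner_comm]
    linarith
  have hF : (P.F xs).toReal = P.zetaReal xs / P.g xs := by
    rw [hP.F_eq_coe hf hΩ, EReal.toReal_coe]
  have hdlim : Tendsto (fun k => P.direction (x (φ k)) (y (φ k))) atTop
      (𝓝 (P.gradh xs - (P.zetaReal xs / P.g xs) • ys)) :=
    hhlim.sub ((hζlim.div hηlim hgpos.ne').smul hylim)
  obtain ⟨b, hopt⟩ := hblock (P.g xs / 2) (half_pos hgpos)
  have hquad : ∀ w ∈ effDom P.f, P.fReal xs ≤ P.fReal w + b * ‖w - xs‖ ^ 2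
      + ⟪P.gradh xs - (P.zetaReal xs / P.g xs) • ys, w - xs⟫_ℝ := by
    intro w hw
    refine le_of_forall_pos_le_add fun ε hε => ?_
    have hN : (0 : ℝ) < N + 1 := by positivity
    have hev : ∀ᶠ t in atTop, ∀ i : Fin N, P.g xs / 2 ≤ P.etaReal (x t) (y t) →
        ∀ w ∈ effDom (P.fi i), (P.fi i (subvec P.blk i (x t))).toReal
          ≤ (P.fi i w).toReal + b * ‖w - subvec P.blk i (x t)‖ ^ 2
            + ⟪subvec P.blk i (P.direction (x t) (y t)), w - subvec P.blk i (x t)⟫_ℝ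
            + ε / (N + 1) :=
      eventually_all.2 fun i => hopt i _ (div_pos hε hN)
    have hrhs : Tendsto (fun k => P.fReal w + b * ‖w - x (φ k)‖ ^ 2
        + ⟪P.direction (x (φ k)) (y (φ k)), w - x (φ k)⟫_ℝ + ε) atTop
        (𝓝 (P.fReal w + b * ‖w - xs‖ ^ 2
          + ⟪P.gradh xs - (P.zetaReal xs / P.g xs) • ys, w - xs⟫_ℝ + ε)) :=
      ((((((hxlim.const_sub w).norm.pow 2).const_mul b).const_add (P.fReal w)).add
        (hdlim.inner (hxlim.const_sub w))).add_const ε)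
    refine le_of_tendsto_of_tendsto hflim hrhs ?_
    filter_upwards [hφ'.eventually hev, hηlim.eventually (lt_mem_nhds (half_lt_self hgpos))]
      with k hk hηk
    have hsum := Finset.sum_le_sum fun (i : Fin N) (_ : i ∈ Finset.univ) =>
      hk i hηk.le (subvec P.blk i w) (hP.mem_effDom_f_iff.1 hw i)
    simp only [← subvec_sub, Finset.sum_add_distrib, ← Finset.mul_sum,
      ← norm_sq_eq_sum_subvec, ← inner_eq_sum_subvec, Finset.sum_const, Finset.card_univ,
      Fintype.card_fin, nsmul_eq_mul] at hsum
    have hε' : (N : ℝ) * (ε / (N + 1)) ≤ ε := by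
      rw [mul_div_assoc', div_le_iff₀ hN]
      nlinarith
    change P.fReal (x (φ k)) ≤ P.fReal w + _ + _ + _ at hsum
    linarith
  have hfre : (P.zetaReal xs / P.g xs) • ys - P.gradh xs ∈ frechetSubdiff P.f xs := by
    refine mem_frechetSubdiff_of_quadratic hP.f_ne_bot hf (C := b)
      (Eventually.of_forall fun w hw => ?_)
    have h1 := hquad w hw
    rw [hP.toReal_f hf, hP.toReal_f hw]
    rw [← neg_sub ((P.zetaReal xs / P.g xs) • ys), inner_neg_left] at h1
    linarith
  refine ⟨⟨hP.mem_effDom_F_iff.2 ⟨hΩ, hf⟩, ?_⟩, Set.smul_mem_smul_set hsub⟩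
  rw [hF, Set.mem_sub]
  exact ⟨_, ⟨_, hfre, _, rfl, rfl⟩, _, Set.smul_mem_smul_set hsub, by simp⟩

/-! ### The random index -/

/-- If almost surely the iterates avoid `W` at all late times at which the index `i` is picked, then
they avoid `W` at all late times. -/
theorem IsRMPGA.ae_eventually_notMem {S : Type*} {mS : MeasurableSpace S} {μ : Measure S}
    [IsProbabilityMeasure μ] {ℱ : Filtration ℕ mS} {c : MPGAParams} {x₀ y₀ : Rn n} {pmin : ℝ}
    (hpmin : 0 < pmin) {p : ℕ → Fin (N + 1) → S → ℝ} {idx : ℕ → S → Fin (N + 1)}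
    {x y : ℕ → S → Rn n} (h : P.IsRMPGA μ ℱ c x₀ y₀ pmin p idx x y) (i : Fin (N + 1))
    {W : Set (Rn n × Rn n)} (hW : MeasurableSet W)
    (hev : ∀ᵐ ω ∂μ, ∀ᶠ t in atTop, idx t ω = i → (x t ω, y t ω) ∉ W) :
    ∀ᵐ ω ∂μ, ∀ᶠ t in atTop, (x t ω, y t ω) ∉ W := by
  have hA : ∀ t, MeasurableSet (idx t ⁻¹' {i}) := fun t =>
    h.idx_measurable t (measurableSet_singleton i)
  refine ae_eventually_notMem_of_le_measure_inter (ℱ := ℱ) (p := ENNReal.ofReal pmin)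
    (A := fun t => idx t ⁻¹' {i}) (G := fun t => {ω | (x t ω, y t ω) ∈ W})
    (by simpa using hpmin) hA (fun t s hs => ?_) (fun t => ?_) ?_
  · refine ofReal_mul_measure_le_measure_inter (ℱ.le t) (hA t) ?_ hs
    filter_upwards [h.p_condProb t i, h.p_ge t i] with ω h1 h2
    rwa [h1] at h2
  · exact ((h.x_adapted t).prodMk (h.y_adapted t)) hW
  · filter_upwards [hev] with ω hω
    filter_upwards [hω] with t ht hG hA
    exact ht hA hG

/-- The set of states that violate the block optimality inequality by more than `ε` is Borel: it is
the preimage of an open set, as the inequality depends continuously on the state once the comparison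
point `w` is fixed. -/
theorem Standing.measurableSet_block_violation (hP : P.Standing) (η₀ b ε : ℝ) (i : Fin N) :
    MeasurableSet {z : Rn n × Rn n | η₀ ≤ P.etaReal z.1 z.2 ∧ ∃ w ∈ effDom (P.fi i),
      (P.fi i w).toReal + b * ‖w - subvec P.blk i z.1‖ ^ 2
        + ⟪subvec P.blk i (P.direction z.1 z.2), w - subvec P.blk i z.1⟫_ℝ + ε
        < (P.fi i (subvec P.blk i z.1)).toReal} := by
  refine (measurableSet_le measurable_const P.measurable_etaReal).inter ?_
  have hopen : IsOpen {s : BlockSpace P.blk i × BlockSpace P.blk i × ℝ |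
      ∃ w ∈ effDom (P.fi i), (P.fi i w).toReal + b * ‖w - s.1‖ ^ 2 + ⟪s.2.1, w - s.1⟫_ℝ + ε
        < s.2.2} := by
    simp only [Set.ofPred_exists]
    refine isOpen_iUnion fun w => ?_
    by_cases hw : w ∈ effDom (P.fi i)
    · simp only [hw, true_and]
      exact isOpen_lt (by fun_prop) (by fun_prop)
    · simp [hw]
  have hsub : Measurable fun z : Rn n × Rn n => subvec P.blk i z.1 :=
    (continuous_subvec i).measurable.comp measurable_fst
  have hmeas : Measurable fun z : Rn n × Rn n => (subvec P.blk i z.1,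
      subvec P.blk i (P.direction z.1 z.2), (P.fi i (subvec P.blk i z.1)).toReal) :=
    hsub.prodMk (((continuous_subvec i).measurable.comp hP.measurable_direction).prodMk
      ((hP.measurable_fi_toReal i).comp hsub))
  exact hmeas hopen.measurableSet

end FracProblem

/-! ### Almost sure convergence -/

theorem mainTheorem8 {n N : ℕ} (P : FracProblem n N) (hP : P.Standing) (c : MPGAParams)
    (x₀ y₀ : Rn n) (hx₀ : x₀ ∈ effDom P.F) (hy₀ : y₀ ∈ convexSubdiff P.g x₀)
    (hX : IsCompact {x : Rn n | P.F x ≤ P.F x₀})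
    {S : Type*} {mS : MeasurableSpace S} (μ : Measure S) [IsProbabilityMeasure μ]
    (ℱ : Filtration ℕ mS) (pmin : ℝ) (hpmin : 0 < pmin) (p : ℕ → Fin (N + 1) → S → ℝ)
    (idx : ℕ → S → Fin (N + 1)) (x y : ℕ → S → Rn n)
    (hrun : P.IsRMPGA μ ℱ c x₀ y₀ pmin p idx x y) :
    ∀ᵐ ω ∂μ, ∀ xs ys : Rn n,
      MapClusterPt (xs, ys) atTop (fun t : ℕ => (x t ω, y t ω)) →
        P.IsCritical xs ∧
          (P.F xs).toReal • ys ∈ (P.F xs).toReal • convexSubdiff P.g xs := by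
  set X := {x : Rn n | P.F x ≤ P.F x₀} with hXdef
  have hXdom : ∀ u ∈ X, u ∈ P.Omega ∧ u ∈ effDom P.f := fun u hu =>
    hP.mem_effDom_F_iff.1 (show P.F u < ⊤ from lt_of_le_of_lt hu hx₀)
  have hXf : X ⊆ effDom P.f := fun u hu => (hXdom u hu).2
  have hXΩ : X ⊆ P.Omega := fun u hu => (hXdom u hu).1
  obtain ⟨hΩ₀, hf₀⟩ := hP.mem_effDom_F_iff.1 hx₀
  set K := P.zetaReal x₀ / P.g x₀ with hK
  have hreal : ∀ᵐ ω ∂μ, ∃ R, P.RealRun c K (fun t => idx t ω) (fun t => x t ω) (fun t => y t ω) R ∧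
      ∀ t, x t ω ∈ X := by
    filter_upwards [hrun.run] with ω hω
    obtain ⟨R, hR⟩ := hP.exists_realRun hx₀ hy₀ hω
    refine ⟨R, hR, fun t => ?_⟩
    have h1 := hR.F_le hP t
    rwa [← hP.F_eq_coe hf₀ hΩ₀] at h1
  -- Tolerances and lower bounds on `η` run through the numbers `1 / (k + 1)`, so that only
  -- countably many null sets have to be discarded.
  have hgap : ∀ k : ℕ, ∀ᵐ ω ∂μ, ∀ᶠ t in atTop, (x t ω, y t ω) ∉ {z : Rn n × Rn n |
      1 / ((k : ℝ) + 1) < P.zetaReal z.1 * (P.g z.1 - P.etaReal z.1 z.2)} := by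
    intro k
    refine hrun.ae_eventually_notMem hpmin 0 (measurableSet_lt measurable_const
      ((hP.measurable_zetaReal.comp measurable_fst).mul
        ((hP.continuous_g.measurable.comp measurable_fst).sub P.measurable_etaReal))) ?_
    filter_upwards [hreal] with ω hω
    obtain ⟨R, hR, hxX⟩ := hω
    filter_upwards [hR.eventually_gap_le hP hX hXf hXΩ hxX (Nat.one_div_pos_of_nat (n := k))]
      with t ht hi
    exact not_lt.2 (ht hi)
  choose b hopt using fun m : ℕ => FracProblem.RealRun.exists_eventually_block_optimal hP c K hX
    hXf hXΩ (Nat.one_div_pos_of_nat (α := ℝ) (n := m))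
  have hblock : ∀ (m : ℕ) (i : Fin N) (k : ℕ), ∀ᵐ ω ∂μ, ∀ᶠ t in atTop,
      (x t ω, y t ω) ∉ {z : Rn n × Rn n | 1 / ((m : ℝ) + 1) ≤ P.etaReal z.1 z.2 ∧
        ∃ w ∈ effDom (P.fi i), (P.fi i w).toReal + b m * ‖w - subvec P.blk i z.1‖ ^ 2
          + ⟪subvec P.blk i (P.direction z.1 z.2), w - subvec P.blk i z.1⟫_ℝ + 1 / ((k : ℝ) + 1)
          < (P.fi i (subvec P.blk i z.1)).toReal} := by
    intro m i k
    refine hrun.ae_eventually_notMem hpmin i.succ (hP.measurableSet_block_violation _ _ _ i) ?_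
    filter_upwards [hreal] with ω hω
    obtain ⟨R, hR, hxX⟩ := hω
    filter_upwards [hopt m _ _ _ R hR hxX i _ (Nat.one_div_pos_of_nat (n := k))] with t ht hi
    rintro ⟨hη, w, hw, hlt⟩
    exact not_lt.2 (ht hi hη w hw) hlt
  filter_upwards [hreal, ae_all_iff.2 hgap,
    ae_all_iff.2 fun m => ae_all_iff.2 fun i => ae_all_iff.2 (hblock m i)]
    with ω ⟨R, hR, hxX⟩ hgapω hblockω xs ys hcl
  refine hR.isCritical_of_mapClusterPt hP hX hXf hXΩ hxX ?_ ?_ hcl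
  · rw [Metric.tendsto_nhds]
    intro ε hε
    obtain ⟨k, hk⟩ := exists_nat_one_div_lt hε
    filter_upwards [hgapω k] with t ht
    have ha := hR.admissible t
    have hnn := mul_nonneg (hP.zetaReal_nonneg ha.mem_dom_f ha.mem_Omega)
      (sub_nonneg.2 (P.etaReal_le_g ha.mem_dom_conj (x t ω)))
    rw [Real.dist_eq, sub_zero, abs_of_nonneg hnn]
    exact (not_lt.1 ht).trans_lt hk
  · intro η₀ hη₀
    obtain ⟨m, hm⟩ := exists_nat_one_div_lt hη₀
    refine ⟨b m, fun i ε hε => ?_⟩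
    obtain ⟨k, hk⟩ := exists_nat_one_div_lt hε
    filter_upwards [hblockω m i k] with t ht hη w hw
    by_contra hcon
    exact ht ⟨hm.le.trans hη, w, hw, by linarith [not_le.1 hcon]⟩
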